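/- Let $d\in\{2,3\}$, let $D\subset\mathbb R^d$ be a bounded open set with $0\in D$, and let $B\subset\mathbb R^d$ be a bounded open set with $C^\infty$ boundary, lying locally on one side of it (for instance a smooth deformation of a ball centered at the origin), with outward unit normal $\nu$ on $\partial B$. Let $A,A_1\in\mathbb R^{d\times d}$ be constant symmetric positive definite matrices, $\widetilde A=A_1\chi_B+A(1-\chi_B)$, and $A_{min}=\inf_{\xi\in\mathbb C^d,\,|\xi|=1}\overline\xi\cdot A\xi>0$. Let $w:D\to\mathbb C$ be a smooth function. For small $\varepsilon>0$ put $\widetilde D=\frac1\varepsilon D$ and let $w^{(1)}_\varepsilon\in H^1_0(\widetilde D)$ be the solution of $$\int_{\widetilde D}\widetilde A\nabla w^{(1)}_\varepsilon\cdot\nabla\overline\varphi+A_{min}\,w^{(1)}_\varepsilon\overline\varphi\,dy=\int_{\partial B}\big[(A_1-A)\nabla w(0)\cdot\nu\big]\overline\varphi\,ds\qquad\text{for all }\varphi\in C_c^\infty(\widetilde D;\mathbb C)$$ (equivalently, for all $\varphi\in H^1_0(\widetilde D)$), and let $w^{(1)}\in H^1(\mathbb R^d)$ be the solution of $$\int_{\mathbb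 R^d}\widetilde A\nabla w^{(1)}\cdot\nabla\overline\varphi+A_{min}\,w^{(1)}\overline\varphi\,dy=\int_{\partial B}\big[(A_1-A)\nabla w(0)\cdot\nu\big]\overline\varphi\,ds\qquad\text{for all }\varphi\in C_c^\infty(\mathbb R^d;\mathbb C)$$ (equivalently, for all $\varphi\in H^1(\mathbb R^d)$). Then, for all sufficiently small $\varepsilon>0$, the function $x\mapsto w^{(1)}_\varepsilon(x/\varepsilon)-w^{(1)}(x/\varepsilon)$ belongs to $H^1(D)$, and as $\varepsilon\to0^+$ $$\|w^{(1)}_\varepsilon(x/\varepsilon)-w^{(1)}(x/\varepsilon)\|_{H^1(D)}=o(\varepsilon^{d/2+2})\quad\text{if }d=2,$$ $$\|w^{(1)}_\varepsilon(x/\varepsilon)-w^{(1)}(x/\varepsilon)\|_{H^1(D)}=o(\varepsilon^{d/2+5/2})\quad\text{if }d=3.$$ -/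

import Mathlib

open MeasureTheory Filter Topology Asymptotics
open scoped ContDiff Pointwise ComplexConjugate

noncomputable section

/-- Euclidean space of dimension `d`, with the Euclidean norm. -/
abbrev Eu (d : ℕ) : Type := EuclideanSpace ℝ (Fin d)

/-- The classical partial derivative of `f` at `x` in the `i`-th coordinate direction. -/
def partialD {d : ℕ} {F : Type*} [NormedAddCommGroup F] [NormedSpace ℝ F]
    (i : Fin d) (f : Eu d → F) (x : Eu d) : F :=
  fderiv ℝ f x (EuclideanSpace.single i 1)

/-- Smooth functions with compact support contained in `Ω`. -/
def IsTest {d : ℕ} {F : Type*} [NormedAddCommGroup F] [NormedSpace ℝ F]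
    (Ω : Set (Eu d)) (φ : Eu d → F) : Prop :=
  ContDiff ℝ ∞ φ ∧ HasCompactSupport φ ∧ tsupport φ ⊆ Ω

/-- `g` is a square integrable weak `i`-th partial derivative of `u` on the open set `Ω`. -/
def HasWeakPartial {d : ℕ} (Ω : Set (Eu d)) (i : Fin d) (u g : Eu d → ℂ) : Prop :=
  MemLp g 2 (volume.restrict Ω) ∧
    ∀ φ : Eu d → ℝ, IsTest Ω φ →
      ∫ x in Ω, partialD i φ x • u x = -∫ x in Ω, φ x • g x

/-- `u ∈ H¹(Ω)`: `u` and its first weak partial derivatives are square integrable on `Ω`. -/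
def MemH1 {d : ℕ} (Ω : Set (Eu d)) (u : Eu d → ℂ) : Prop :=
  MemLp u 2 (volume.restrict Ω) ∧ ∀ i : Fin d, ∃ g, HasWeakPartial Ω i u g

open Classical in
/-- The `i`-th weak partial derivative of `u` on `Ω` (unique up to null sets; `0` if there is
none). -/
def weakPartial {d : ℕ} (Ω : Set (Eu d)) (i : Fin d) (u : Eu d → ℂ) : Eu d → ℂ :=
  if h : ∃ g, HasWeakPartial Ω i u g then h.choose else 0

/-- The norm of `H¹(Ω)`, to be used for `u` with `MemH1 Ω u`. -/
def h1Norm {d : ℕ} (Ω : Set (Eu d)) (u : Eu d → ℂ) : ℝ :=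
  Real.sqrt ((∫ x in Ω, ‖u x‖ ^ 2) + ∑ i : Fin d, ∫ x in Ω, ‖weakPartial Ω i u x‖ ^ 2)

/-- `u ∈ H¹₀(Ω)`: the closure in `H¹(Ω)` of the smooth functions with compact support in `Ω`. -/
def MemH10 {d : ℕ} (Ω : Set (Eu d)) (u : Eu d → ℂ) : Prop :=
  MemH1 Ω u ∧ ∃ φ : ℕ → Eu d → ℂ, (∀ n, IsTest Ω (φ n)) ∧
    Tendsto (fun n => h1Norm Ω (fun x => u x - φ n x)) atTop (𝓝 0)

/-- `ρ` is a smooth defining function of `B` near the boundary point `y`. -/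
def IsDefiningFunction {d : ℕ} (B : Set (Eu d)) (y : Eu d) (ρ : Eu d → ℝ) : Prop :=
  ContDiff ℝ ∞ ρ ∧ gradient ρ y ≠ 0 ∧ ∀ᶠ x in 𝓝 y, (x ∈ B ↔ ρ x < 0)

/-- The boundary of `B` is smooth, with `B` locally on one side of it. -/
def HasSmoothBoundary {d : ℕ} (B : Set (Eu d)) : Prop :=
  ∀ y ∈ frontier B, ∃ ρ, IsDefiningFunction B y ρ

open Classical in
/-- The outward unit normal of `B` at a boundary point `y`: the normalized gradient of any defining
function (see `outwardNormal_eq`). -/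
def outwardNormal {d : ℕ} (B : Set (Eu d)) (y : Eu d) : Eu d :=
  if h : ∃ ρ, IsDefiningFunction B y ρ then
    ‖gradient h.choose y‖⁻¹ • gradient h.choose y
  else 0

theorem IsDefiningFunction.inner_nonpos {d : ℕ} {B : Set (Eu d)} {y : Eu d} {ρ σ : Eu d → ℝ}
    (hρ : IsDefiningFunction B y ρ) (hσ : IsDefiningFunction B y σ) (hy : y ∈ frontier B)
    (v : Eu d) (hv : inner ℝ (gradient ρ y) v < 0) : inner ℝ (gradient σ y) v ≤ 0 := by
  have zero : ∀ {τ : Eu d → ℝ}, IsDefiningFunction B y τ → τ y = 0 := by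
    intro τ hτ
    obtain ⟨h1, -, h3⟩ := hτ
    rcases lt_trichotomy (τ y) 0 with h | h | h
    · exfalso
      have h4 := h1.continuous.continuousAt.eventually (gt_mem_nhds h)
      have h5 : ∀ᶠ x in 𝓝 y, x ∈ B := by
        filter_upwards [h3, h4] with x hx hx'
        exact hx.2 hx'
      exact hy.2 (mem_interior_iff_mem_nhds.2 h5)
    · exact h
    · exfalso
      have h4 := h1.continuous.continuousAt.eventually (lt_mem_nhds h)
      obtain ⟨x, hx, hx'⟩ := (mem_closure_iff_frequently.1 hy.1).and_eventually
        (h3.and h4) |>.exists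
      exact absurd (hx'.1.1 hx) (not_lt.2 hx'.2.le)
  have der : ∀ {τ : Eu d → ℝ}, IsDefiningFunction B y τ →
      HasDerivAt (fun t : ℝ => τ (y + t • v)) (inner ℝ (gradient τ y) v) 0 := by
    intro τ hτ
    have h1 : HasFDerivAt τ (InnerProductSpace.toDual ℝ (Eu d) (gradient τ y)) (y + (0 : ℝ) • v) := by
      have := ((hτ.1.differentiable (by simp)) y).hasGradientAt.hasFDerivAt
      simpa using this
    have h2 : HasDerivAt (fun t : ℝ => y + t • v) v 0 := by
      simpa using ((hasDerivAt_id (0 : ℝ)).smul_const v).const_add y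
    have h3 := h1.comp_hasDerivAt (0 : ℝ) h2
    rw [InnerProductSpace.toDual_apply_apply] at h3
    exact h3
  by_contra! hcon
  have tend : Tendsto (fun t : ℝ => y + t • v) (𝓝[>] 0) (𝓝 y) := by
    have : Continuous (fun t : ℝ => y + t • v) := by fun_prop
    simpa using (this.tendsto 0).mono_left (nhdsWithin_le_nhds (s := Set.Ioi 0))
  have sρ := (hasDerivAt_iff_tendsto_slope.1 (der hρ)).eventually (gt_mem_nhds hv)
  have sσ := (hasDerivAt_iff_tendsto_slope.1 (der hσ)).eventually (lt_mem_nhds hcon)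
  have hle : 𝓝[>] (0 : ℝ) ≤ 𝓝[≠] 0 := nhdsWithin_mono _ (fun x hx => ne_of_gt hx)
  obtain ⟨t, ⟨⟨⟨h1, h2⟩, h3⟩, h4⟩, h5⟩ := (((((sρ.filter_mono hle).and (sσ.filter_mono hle)).and
    (tend.eventually hρ.2.2)).and (tend.eventually hσ.2.2)).and self_mem_nhdsWithin).exists
  have ht : (0 : ℝ) < t := h5
  simp only [slope_def_field, zero_smul, add_zero, zero hρ, zero hσ, sub_zero] at h1 h2
  have h6 : ρ (y + t • v) < 0 := by
    by_contra! h
    exact absurd h1 (not_lt.2 (div_nonneg h ht.le))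
  have h7 : 0 < σ (y + t • v) := by
    by_contra! h
    exact absurd h2 (not_lt.2 (div_nonpos_of_nonpos_of_nonneg h ht.le))
  exact absurd (h4.1 (h3.2 h6)) (not_lt.2 h7.le)

theorem outwardNormal_eq {d : ℕ} {B : Set (Eu d)} {y : Eu d} (hy : y ∈ frontier B)
    {ρ : Eu d → ℝ} (hρ : IsDefiningFunction B y ρ) :
    outwardNormal B y = ‖gradient ρ y‖⁻¹ • gradient ρ y := by
  have h : ∃ ρ, IsDefiningFunction B y ρ := ⟨ρ, hρ⟩
  rw [outwardNormal, dif_pos h]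
  have key := hρ.inner_nonpos h.choose_spec hy
  have hb := h.choose_spec.2.1
  have ha := hρ.2.1
  generalize gradient h.choose y = b at *
  generalize gradient ρ y = a at *
  have haa : 0 < inner ℝ a a := real_inner_self_pos.2 ha
  set t : ℝ := inner ℝ a b / inner ℝ a a with ht
  set c : Eu d := b - t • a with hc
  have hac : inner ℝ a c = 0 := by
    rw [hc, inner_sub_right, inner_smul_right, ht]; field_simp; ring
  have hbc : inner ℝ b c = inner ℝ c c := by
    have : b = c + t • a := by rw [hc]; abel
    conv_lhs => rw [this]
    rw [inner_add_left, inner_smul_left, hac]; simp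
  have h1 : ∀ δ : ℝ, 0 < δ → inner ℝ c c ≤ δ * inner ℝ b a := by
    intro δ hδ
    have := key (c - δ • a) (by
      rw [inner_sub_right, inner_smul_right, hac]; nlinarith [mul_pos hδ haa])
    rw [inner_sub_right, inner_smul_right, hbc] at this
    linarith
  have hcc : inner ℝ c c ≤ 0 := by
    by_contra! hpos
    have h2 := h1 1 one_pos
    have h3 : 0 < inner ℝ b a := by linarith
    have h4 := h1 (inner ℝ c c / (2 * inner ℝ b a)) (by positivity)
    have h5 : inner ℝ c c / (2 * inner ℝ b a) * inner ℝ b a = inner ℝ c c / 2 := by field_simp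
    linarith
  have hc0 : c = 0 := by
    rw [real_inner_self_eq_norm_sq] at hcc
    exact norm_eq_zero.1 (pow_eq_zero_iff (two_ne_zero)|>.1 (le_antisymm hcc (sq_nonneg _)))
  have hbt : b = t • a := by rw [hc] at hc0; exact sub_eq_zero.1 hc0
  have ht0 : 0 ≤ t := by
    have := key (-a) (by rw [inner_neg_right]; linarith)
    rw [inner_neg_right, hbt, inner_smul_left] at this
    simp only [conj_trivial] at this
    by_contra! hneg
    nlinarith [mul_pos_of_neg_of_neg hneg (neg_lt_zero.2 haa)]
  have htp : 0 < t := lt_of_le_of_ne ht0 (by rintro h; rw [← h] at hbt; exact hb (by simpa using hbt))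
  rw [hbt, norm_smul, Real.norm_of_nonneg ht0, smul_smul]
  congr 1
  field_simp

/-- The least value of `ξ̄ · A ξ` over the complex unit vectors `ξ` (for symmetric `A`, the
smallest eigenvalue). -/
def Amin {d : ℕ} (A : Matrix (Fin d) (Fin d) ℝ) : ℝ :=
  ⨅ ξ : Metric.sphere (0 : EuclideanSpace ℂ (Fin d)) 1,
    (∑ i, ∑ j, conj (ξ.1 i) * (A i j : ℂ) * ξ.1 j).re

open Classical in
/-- The coefficient equal to `A₁` in `B` and to `A` outside `B`. -/
def coeff {d : ℕ} (A A₁ : Matrix (Fin d) (Fin d) ℝ) (B : Set (Eu d)) (y : Eu d) :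
    Matrix (Fin d) (Fin d) ℝ :=
  if y ∈ B then A₁ else A

/-- The form `∫_Ω Ã ∇u · ∇φ̄ + A_min u φ̄ dy`, for `u ∈ H¹(Ω)` and smooth `φ`. -/
def correctorForm {d : ℕ} (A A₁ : Matrix (Fin d) (Fin d) ℝ) (B Ω : Set (Eu d))
    (u φ : Eu d → ℂ) : ℂ :=
  ∫ y in Ω, ((∑ i, ∑ j, (coeff A A₁ B y i j : ℂ) * weakPartial Ω j u y * conj (partialD i φ y))
    + (Amin A : ℂ) * u y * conj (φ y))

/-- The boundary term `∫_{∂B} [(A₁ - A) p · ν] φ̄ ds` for a constant vector `p ∈ ℂᵈ`, with the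
surface measure of `∂B` (the normalized `(d-1)`-dimensional Hausdorff measure). -/
def boundaryTerm {d : ℕ} (A A₁ : Matrix (Fin d) (Fin d) ℝ) (B : Set (Eu d)) (p : Fin d → ℂ)
    (φ : Eu d → ℂ) : ℂ :=
  ∫ y in frontier B,
    (∑ i, (∑ j, ((A₁ - A) i j : ℂ) * p j) * (outwardNormal B y i : ℂ)) * conj (φ y)
      ∂(Measure.euclideanHausdorffMeasure (d - 1))

/-- The variational equation of the corrector on `Ω`, with the dense class of smooth compactly
supported test functions. -/
def CorrectorEq {d : ℕ} (A A₁ : Matrix (Fin d) (Fin d) ℝ) (B Ω : Set (Eu d)) (p : Fin d → ℂ)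
    (u : Eu d → ℂ) : Prop :=
  ∀ φ : Eu d → ℂ, IsTest Ω φ → correctorForm A A₁ B Ω u φ = boundaryTerm A A₁ B p φ

/-- `u` is the corrector on the bounded open set `Ω`, with zero Dirichlet condition:
`u ∈ H¹₀(Ω)` solves the variational equation. -/
def IsDirichletCorrector {d : ℕ} (A A₁ : Matrix (Fin d) (Fin d) ℝ) (B Ω : Set (Eu d))
    (p : Fin d → ℂ) (u : Eu d → ℂ) : Prop :=
  MemH10 Ω u ∧ CorrectorEq A A₁ B Ω p u

/-- `u` is the whole-space corrector: `u ∈ H¹(ℝᵈ)` solves the variational equation. -/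
def IsWholeSpaceCorrector {d : ℕ} (A A₁ : Matrix (Fin d) (Fin d) ℝ) (B : Set (Eu d))
    (p : Fin d → ℂ) (u : Eu d → ℂ) : Prop :=
  MemH1 Set.univ u ∧ CorrectorEq A A₁ B Set.univ p u

end

open scoped ENNReal

noncomputable section

/-! The zeroth-order term makes the form coercive on all of H¹, so the whole-space corrector w
decays faster than any power of the radius. The Dirichlet problem on D/ε differs from the
whole-space problem only at distance of order 1/ε from B, so the two correctors differ by less than
any power of ε.

Decay: outside a ball containing B and its boundary the source vanishes. Testing with ζw, where ζ is
a cut-off living on |y| ≥ R with gradient O(1/R), bounds the energy on |y| ≥ 2R by C/R times the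
energy on |y| ≥ R (`energy_shell_le`, `tail_energy_doubling`). Each doubling gains one power of 1/R,
so k doublings give a tail energy O(R^(-k)) (`exists_le_div_pow_of_doubling`). Polynomial decay of
high order suffices; no exponential weights are needed.

Comparison: let u be the Dirichlet corrector, v = u - w, and β a cut-off equal to 1 on |y| ≤ R and
supported in D/ε. Then v satisfies the homogeneous equation, and u - βw = v + (1 - β)w is admissible
as a test function. Coercivity and Young's inequality, as in Céa's lemma, bound the energy of v by
that of (1 - β)w, hence by the tail energy of w (`exists_energy_sub_le`).

Scaling: with R comparable to 1/ε, the change of variables costs a factor ε^(d/2 - 1) in the H¹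
norm. A tail of order R^(-8) contributes ε⁴, giving O(ε^(d/2 + 3)), which covers both dimensions.
The preliminary work on mollification extends the equations from smooth test functions to ζw, βw and
u. -/

/-! ### Mollification in L² -/

/-- Translation is continuous in `L²`. -/
theorem tendsto_eLpNorm_comp_sub {d : ℕ} {u : Eu d → ℂ} (hu : MemLp u 2 volume) :
    Tendsto (fun z : Eu d => eLpNorm (fun x => u (x - z) - u x) 2 volume) (𝓝 0) (𝓝 0) := by
  let T : C(Eu d, C(Eu d, Eu d)) :=
    (ContinuousMap.mk (fun a : Eu d × Eu d => a.2 - a.1) (by fun_prop)).curry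
  have hT : ∀ z, MeasurePreserving (T z) volume volume := fun z =>
    measurePreserving_sub_right volume z
  have h1 : Tendsto (fun z => Lp.compMeasurePreserving (T z) (hT z) (hu.toLp u)) (𝓝 0)
      (𝓝 (Lp.compMeasurePreserving (T 0) (hT 0) (hu.toLp u))) :=
    Filter.Tendsto.compMeasurePreservingLp tendsto_const_nhds (T.continuous.tendsto 0) hT (hT 0)
      (by simp)
  rw [Lp.tendsto_Lp_iff_tendsto_eLpNorm'] at h1
  refine h1.congr fun z => ?_
  apply eLpNorm_congr_ae
  rw [Lp.toLp_compMeasurePreserving hu (hT z), Lp.toLp_compMeasurePreserving hu (hT 0)]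
  filter_upwards [(hu.comp_measurePreserving (hT z)).coeFn_toLp,
    (hu.comp_measurePreserving (hT 0)).coeFn_toLp] with x h2 h3
  simp [h2, h3, T]

theorem eLpNorm_two_sq {α E : Type*} [MeasurableSpace α] [NormedAddCommGroup E] (μ : Measure α)
    (f : α → E) : eLpNorm f 2 μ ^ 2 = ∫⁻ x, ‖f x‖ₑ ^ 2 ∂μ := by
  have := eLpNorm_nnreal_pow_eq_lintegral (f := f) (μ := μ) (p := 2) (by norm_num)
  simpa using this

/-- Jensen's inequality: the normed bump is a probability density, so the square of the mean of u(x
- z) - u(x) is at most the mean of the square. -/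
theorem enorm_convolution_sub_sq_le {d : ℕ} {u : Eu d → ℂ} (hu : MemLp u 2 volume)
    (ρ : ContDiffBump (0 : Eu d)) (x : Eu d) :
    ‖(convolution (ρ.normed volume) u (ContinuousLinearMap.lsmul ℝ ℝ) volume) x - u x‖ₑ ^ 2 ≤
      ∫⁻ z, ENNReal.ofReal (ρ.normed volume z) * ‖u (x - z) - u x‖ₑ ^ 2 := by
  have hloc : LocallyIntegrable u volume := hu.locallyIntegrable (by norm_num)
  have hex := (ρ.hasCompactSupport_normed (μ := volume)).convolutionExists_left
    (ContinuousLinearMap.lsmul ℝ ℝ) ρ.continuous_normed hloc x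
  have hi2 : Integrable (fun z => ρ.normed volume z • u x) volume :=
    (ρ.integrable_normed (μ := volume)).smul_const (u x)
  have h1 : (convolution (ρ.normed volume) u (ContinuousLinearMap.lsmul ℝ ℝ) volume) x - u x
      = ∫ z, ρ.normed volume z • (u (x - z) - u x) := by
    have h0 : Integrable (fun z => ρ.normed volume z • u (x - z)) volume := hex
    simp_rw [smul_sub]
    rw [integral_sub h0 hi2, integral_smul_const, ρ.integral_normed, one_smul]
    rfl
  have hm : Measurable fun z => ENNReal.ofReal (ρ.normed volume z) :=
    (ρ.continuous_normed (μ := volume)).measurable.ennreal_ofReal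
  set ν := volume.withDensity fun z => ENNReal.ofReal (ρ.normed volume z) with hν
  have : IsProbabilityMeasure ν := by
    refine ⟨?_⟩
    rw [hν, withDensity_apply _ MeasurableSet.univ, Measure.restrict_univ,
      ← ofReal_integral_eq_lintegral_ofReal ρ.integrable_normed
        (Eventually.of_forall ρ.nonneg_normed), ρ.integral_normed, ENNReal.ofReal_one]
  have hmeas : AEStronglyMeasurable (fun z => u (x - z) - u x) volume :=
    (hu.1.comp_measurePreserving (Measure.measurePreserving_sub_left volume x)).sub
      aestronglyMeasurable_const
  have hmeasν : AEStronglyMeasurable (fun z => u (x - z) - u x) ν :=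
    hmeas.mono_ac (withDensity_absolutelyContinuous _ _)
  have h2 : ‖∫ z, ρ.normed volume z • (u (x - z) - u x)‖ₑ ≤
      eLpNorm (fun z => u (x - z) - u x) 1 ν := by
    refine (enorm_integral_le_lintegral_enorm _).trans ?_
    rw [eLpNorm_one_eq_lintegral_enorm, hν,
      lintegral_withDensity_eq_lintegral_mul₀ hm.aemeasurable hmeas.enorm]
    refine lintegral_mono fun z => ?_
    rw [enorm_smul, Real.enorm_of_nonneg (ρ.nonneg_normed z)]
    rfl
  rw [h1]
  calc _ ≤ eLpNorm (fun z => u (x - z) - u x) 2 ν ^ 2 := by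
        gcongr
        exact h2.trans (eLpNorm_le_eLpNorm_of_exponent_le (by norm_num) hmeasν)
    _ = _ := by
        rw [eLpNorm_two_sq, hν, lintegral_withDensity_eq_lintegral_mul₀ hm.aemeasurable
          (hmeas.enorm.pow_const 2)]
        rfl

/-- Integrate the pointwise Jensen bound in x and exchange the integrals: the error is an average of
squared translation errors over the support of the bump. -/
theorem eLpNorm_convolution_sub_le {d : ℕ} {u : Eu d → ℂ} (hu : MemLp u 2 volume)
    (ρ : ContDiffBump (0 : Eu d)) {δ : ℝ≥0∞}
    (hδ : ∀ z ∈ Metric.ball (0 : Eu d) ρ.rOut,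
      eLpNorm (fun x => u (x - z) - u x) 2 volume ≤ δ) :
    eLpNorm (fun x => (convolution (ρ.normed volume) u (ContinuousLinearMap.lsmul ℝ ℝ) volume) x
      - u x) 2 volume ≤ δ := by
  have hm : Measurable fun z => ENNReal.ofReal (ρ.normed volume z) :=
    (ρ.continuous_normed (μ := volume)).measurable.ennreal_ofReal
  have hmm : AEMeasurable (Function.uncurry fun (x z : Eu d) =>
      ENNReal.ofReal (ρ.normed volume z) * ‖u (x - z) - u x‖ₑ ^ 2)
      ((volume : Measure (Eu d)).prod volume) := by
    refine (hm.comp measurable_snd).aemeasurable.mul (AEMeasurable.pow_const ?_ 2)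
    refine AEStronglyMeasurable.enorm (AEStronglyMeasurable.sub ?_ hu.1.comp_fst)
    exact hu.1.comp_quasiMeasurePreserving (quasiMeasurePreserving_sub volume volume)
  have key : eLpNorm (fun x => (convolution (ρ.normed volume) u
      (ContinuousLinearMap.lsmul ℝ ℝ) volume) x - u x) 2 volume ^ 2 ≤ δ ^ 2 := by
    rw [eLpNorm_two_sq]
    calc _ ≤ ∫⁻ x, ∫⁻ z, ENNReal.ofReal (ρ.normed volume z) * ‖u (x - z) - u x‖ₑ ^ 2 :=
          lintegral_mono fun x => enorm_convolution_sub_sq_le hu ρ x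
      _ = ∫⁻ z, ∫⁻ x, ENNReal.ofReal (ρ.normed volume z) * ‖u (x - z) - u x‖ₑ ^ 2 :=
          lintegral_lintegral_swap hmm
      _ ≤ ∫⁻ z, ENNReal.ofReal (ρ.normed volume z) * δ ^ 2 := by
          refine lintegral_mono fun z => ?_
          rw [lintegral_const_mul' _ _ ENNReal.ofReal_ne_top, ← eLpNorm_two_sq]
          by_cases hz : z ∈ Metric.ball (0 : Eu d) ρ.rOut
          · gcongr
            exact hδ z hz
          · rw [← ρ.support_normed_eq (μ := volume), Function.notMem_support] at hz
            simp [hz]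
      _ = δ ^ 2 := by
          rw [lintegral_mul_const _ hm, ← ofReal_integral_eq_lintegral_ofReal ρ.integrable_normed
            (Eventually.of_forall ρ.nonneg_normed), ρ.integral_normed, ENNReal.ofReal_one, one_mul]
  exact (ENNReal.pow_le_pow_left_iff two_ne_zero).1 key

/-- Mollifications converge in `L²`. -/
theorem tendsto_eLpNorm_convolution_sub {d : ℕ} {u : Eu d → ℂ} (hu : MemLp u 2 volume)
    {ρ : ℕ → ContDiffBump (0 : Eu d)} (hρ : Tendsto (fun n => (ρ n).rOut) atTop (𝓝 0)) :
    Tendsto (fun n => eLpNorm (fun x => (convolution ((ρ n).normed volume) u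
      (ContinuousLinearMap.lsmul ℝ ℝ) volume) x - u x) 2 volume) atTop (𝓝 0) := by
  rw [ENNReal.tendsto_nhds_zero]
  intro δ hδ
  have h := (ENNReal.tendsto_nhds_zero.1 (tendsto_eLpNorm_comp_sub hu)) δ hδ
  obtain ⟨r, hr, hr'⟩ := Metric.eventually_nhds_iff_ball.1 h
  filter_upwards [hρ.eventually (gt_mem_nhds hr)] with n hn
  exact eLpNorm_convolution_sub_le hu (ρ n) fun z hz =>
    hr' z (Metric.ball_subset_ball hn.le hz)

/-! ### Classical partial derivatives and test functions -/

section PartialDerivatives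

variable {d : ℕ} {F : Type*} [NormedAddCommGroup F] [NormedSpace ℝ F]

theorem partialD_continuous {f : Eu d → F} (hf : ContDiff ℝ ∞ f) (i : Fin d) :
    Continuous (partialD i f) :=
  (hf.continuous_fderiv (by simp)).clm_apply continuous_const

theorem tsupport_partialD_subset (i : Fin d) (f : Eu d → F) :
    tsupport (partialD i f) ⊆ tsupport f :=
  tsupport_fderiv_apply_subset ℝ _

theorem hasCompactSupport_partialD {f : Eu d → F} (hf : HasCompactSupport f) (i : Fin d) :
    HasCompactSupport (partialD i f) :=
  hf.fderiv_apply (𝕜 := ℝ) _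

theorem partialD_memLp {f : Eu d → F} (hf : ContDiff ℝ ∞ f) (hc : HasCompactSupport f)
    (i : Fin d) (p : ℝ≥0∞) (μ : Measure (Eu d)) [IsFiniteMeasureOnCompacts μ] :
    MemLp (partialD i f) p μ :=
  (partialD_continuous hf i).memLp_of_hasCompactSupport (hasCompactSupport_partialD hc i)

theorem partialD_smul {χ : Eu d → ℝ} {f : Eu d → F} (hχ : ContDiff ℝ ∞ χ) (hf : ContDiff ℝ ∞ f)
    (i : Fin d) (x : Eu d) :
    partialD i (fun y => χ y • f y) x = χ x • partialD i f x + partialD i χ x • f x := by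
  rw [partialD, fderiv_fun_smul ((hχ.differentiable (by simp)) x) ((hf.differentiable (by simp)) x)]
  simp [partialD]

theorem partialD_comp_smul {f : Eu d → F} (hf : ContDiff ℝ ∞ f) (c : ℝ) (i : Fin d) (x : Eu d) :
    partialD i (fun y => f (c • y)) x = c • partialD i f (c • x) := by
  have h : HasFDerivAt (fun y : Eu d => f (c • y))
      ((fderiv ℝ f (c • x)).comp (c • ContinuousLinearMap.id ℝ (Eu d))) x :=
    ((hf.differentiable (by simp)) (c • x)).hasFDerivAt.comp x
      ((hasFDerivAt_id x).const_smul c)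
  simp [partialD, h.fderiv]

theorem partialD_comp_const_sub {f : Eu d → F} (hf : ContDiff ℝ ∞ f) (i : Fin d) (x y : Eu d) :
    partialD i (fun y => f (x - y)) y = -partialD i f (x - y) := by
  have h : HasFDerivAt (fun y : Eu d => f (x - y))
      ((fderiv ℝ f (x - y)).comp (-ContinuousLinearMap.id ℝ (Eu d))) y :=
    ((hf.differentiable (by simp)) (x - y)).hasFDerivAt.comp y ((hasFDerivAt_id y).const_sub x)
  simp [partialD, h.fderiv]

theorem IsTest.eq_zero {Ω : Set (Eu d)} {φ : Eu d → F} (h : IsTest Ω φ) {x : Eu d} (hx : x ∉ Ω) :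
    φ x = 0 :=
  image_eq_zero_of_notMem_tsupport fun h' => hx (h.2.2 h')

theorem IsTest.partialD_eq_zero {Ω : Set (Eu d)} {φ : Eu d → F} (h : IsTest Ω φ) (i : Fin d)
    {x : Eu d} (hx : x ∉ Ω) : partialD i φ x = 0 :=
  image_eq_zero_of_notMem_tsupport fun h' => hx (h.2.2 (tsupport_partialD_subset i φ h'))

theorem IsTest.mono {Ω Ω' : Set (Eu d)} {φ : Eu d → F} (h : IsTest Ω φ) (hs : Ω ⊆ Ω') :
    IsTest Ω' φ :=
  ⟨h.1, h.2.1, h.2.2.trans hs⟩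

end PartialDerivatives

/-! ### Weak derivatives: uniqueness, restriction, dilation -/

section WeakDerivatives

variable {d : ℕ} {Ω Ω' : Set (Eu d)} {i : Fin d} {u v g g' : Eu d → ℂ}

theorem integrable_smul_of_memLp_two {φ : Eu d → ℝ} {μ : Measure (Eu d)}
    [IsFiniteMeasureOnCompacts μ] (hφ : Continuous φ)
    (hc : HasCompactSupport φ) (hu : MemLp u 2 μ) : Integrable (fun x => φ x • u x) μ :=
  memLp_one_iff_integrable.1 (hu.smul (hφ.memLp_of_hasCompactSupport (p := 2) hc))

theorem IsTest.setIntegral_eq {E : Type*} [NormedAddCommGroup E] [NormedSpace ℝ E]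
    {φ : Eu d → ℝ} (h : IsTest Ω φ) (hs : Ω ⊆ Ω') (u : Eu d → E) :
    ∫ x in Ω', φ x • u x = ∫ x in Ω, φ x • u x := by
  rw [setIntegral_eq_integral_of_forall_compl_eq_zero (s := Ω),
    setIntegral_eq_integral_of_forall_compl_eq_zero]
  · intro x hx
    rw [h.eq_zero fun h' => hx (hs h'), zero_smul]
  · intro x hx
    rw [h.eq_zero hx, zero_smul]

theorem IsTest.setIntegral_partialD_eq {E : Type*} [NormedAddCommGroup E] [NormedSpace ℝ E]
    {φ : Eu d → ℝ} (h : IsTest Ω φ) (hs : Ω ⊆ Ω') (i : Fin d) (u : Eu d → E) :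
    ∫ x in Ω', partialD i φ x • u x = ∫ x in Ω, partialD i φ x • u x := by
  rw [setIntegral_eq_integral_of_forall_compl_eq_zero (s := Ω),
    setIntegral_eq_integral_of_forall_compl_eq_zero]
  · intro x hx
    rw [h.partialD_eq_zero i fun h' => hx (hs h'), zero_smul]
  · intro x hx
    rw [h.partialD_eq_zero i hx, zero_smul]

theorem HasWeakPartial.mono (h : HasWeakPartial Ω' i u g) (hs : Ω ⊆ Ω') :
    HasWeakPartial Ω i u g := by
  refine ⟨h.1.mono_measure (Measure.restrict_mono_set _ hs), fun φ hφ => ?_⟩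
  rw [← hφ.setIntegral_partialD_eq hs, ← hφ.setIntegral_eq hs]
  exact h.2 φ (hφ.mono hs)

/-- The fundamental lemma of the calculus of variations. Since `weakPartial` is an arbitrary choice,
this is what allows it to be replaced by an explicit derivative under an integral. -/
theorem HasWeakPartial.ae_eq (hΩ : IsOpen Ω) (h : HasWeakPartial Ω i u g)
    (h' : HasWeakPartial Ω i u g') : g =ᵐ[volume.restrict Ω] g' := by
  have hsub : MemLp (g - g') 2 (volume.restrict Ω) := h.1.sub h'.1
  have hloc : LocallyIntegrableOn (g - g') Ω volume :=
    locallyIntegrableOn_of_locallyIntegrable_restrict (hsub.locallyIntegrable (by norm_num))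
  have key := hΩ.ae_eq_zero_of_integral_contDiff_smul_eq_zero hloc fun φ hφ hc hs => by
    have ht : IsTest Ω φ := ⟨hφ, hc, hs⟩
    have e := ht.setIntegral_eq (Set.subset_univ Ω) (g - g')
    rw [setIntegral_univ] at e
    rw [e]
    simp only [Pi.sub_apply, smul_sub]
    rw [integral_sub (integrable_smul_of_memLp_two hφ.continuous hc h.1)
      (integrable_smul_of_memLp_two hφ.continuous hc h'.1), sub_eq_zero]
    exact neg_injective ((h.2 φ ht).symm.trans (h'.2 φ ht))
  rw [Filter.EventuallyEq, ae_restrict_iff' hΩ.measurableSet]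
  filter_upwards [key] with x hx hxΩ
  exact sub_eq_zero.1 (hx hxΩ)

theorem MemH1.hasWeakPartial (h : MemH1 Ω u) (i : Fin d) :
    HasWeakPartial Ω i u (weakPartial Ω i u) := by
  rw [weakPartial, dif_pos (h.2 i)]
  exact (h.2 i).choose_spec

theorem HasWeakPartial.weakPartial_ae_eq (hΩ : IsOpen Ω) (h : HasWeakPartial Ω i u g) :
    weakPartial Ω i u =ᵐ[volume.restrict Ω] g := by
  have h' : ∃ g, HasWeakPartial Ω i u g := ⟨g, h⟩
  rw [weakPartial, dif_pos h']
  exact h'.choose_spec.ae_eq hΩ h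

theorem HasWeakPartial.sub (hu : MemLp u 2 (volume.restrict Ω)) (hv : MemLp v 2 (volume.restrict Ω))
    (h : HasWeakPartial Ω i u g) (h' : HasWeakPartial Ω i v g') :
    HasWeakPartial Ω i (fun x => u x - v x) (fun x => g x - g' x) := by
  refine ⟨h.1.sub h'.1, fun φ hφ => ?_⟩
  have hp := partialD_continuous hφ.1 i
  have hpc := hasCompactSupport_partialD hφ.2.1 i
  simp only [smul_sub]
  rw [integral_sub (integrable_smul_of_memLp_two hp hpc hu)
      (integrable_smul_of_memLp_two hp hpc hv),
    integral_sub (integrable_smul_of_memLp_two hφ.1.continuous hφ.2.1 h.1)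
      (integrable_smul_of_memLp_two hφ.1.continuous hφ.2.1 h'.1), h.2 φ hφ, h'.2 φ hφ]
  ring

theorem hasWeakPartial_of_contDiff (hu : ContDiff ℝ ∞ u) (hc : HasCompactSupport u) :
    HasWeakPartial Ω i u (partialD i u) := by
  refine ⟨partialD_memLp hu hc i 2 _, fun φ hφ => ?_⟩
  rw [← hφ.setIntegral_eq (Set.subset_univ Ω), ← hφ.setIntegral_partialD_eq (Set.subset_univ Ω),
    setIntegral_univ, setIntegral_univ]
  have hu2 : MemLp u 2 volume := hu.continuous.memLp_of_hasCompactSupport hc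
  have := integral_smul_fderiv_eq_neg_fderiv_smul_of_integrable (μ := (volume : Measure (Eu d)))
    (f := φ) (g := u) (v := EuclideanSpace.single i 1)
    (integrable_smul_of_memLp_two (partialD_continuous hφ.1 i)
      (hasCompactSupport_partialD hφ.2.1 i) hu2)
    (integrable_smul_of_memLp_two hφ.1.continuous hφ.2.1 (partialD_memLp hu hc i 2 volume))
    (integrable_smul_of_memLp_two hφ.1.continuous hφ.2.1 hu2)
    (fun x _ => (hφ.1.differentiable (by simp)) x)
    (fun x _ => (hu.differentiable (by simp)) x)
  exact (neg_eq_iff_eq_neg.2 this).symm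

theorem map_const_smul_restrict {c : ℝ} (hc : 0 < c) (Ω : Set (Eu d)) :
    Measure.map (fun x : Eu d => c • x) (volume.restrict Ω) =
      ENNReal.ofReal |(c ^ Module.finrank ℝ (Eu d))⁻¹| • volume.restrict (c • Ω) := by
  have he : MeasurableEmbedding (fun x : Eu d => c • x) :=
    (Homeomorph.smulOfNeZero c hc.ne').measurableEmbedding
  have hpre : (fun x : Eu d => c • x) ⁻¹' (c • Ω) = Ω := by
    rw [← Set.image_smul]
    exact Set.preimage_image_eq _ (smul_right_injective _ hc.ne')
  rw [← Measure.restrict_smul, ← Measure.map_addHaar_smul volume hc.ne', he.restrict_map, hpre]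

theorem memLp_comp_const_smul {c : ℝ} (hc : 0 < c) (h : MemLp u 2 (volume.restrict (c • Ω))) :
    MemLp (fun x => u (c • x)) 2 (volume.restrict Ω) := by
  refine MemLp.comp_of_map (f := fun x => c • x) ?_ (by fun_prop)
  rw [map_const_smul_restrict hc]
  exact h.smul_measure ENNReal.ofReal_ne_top

/-- Weak derivatives under dilation. -/
theorem HasWeakPartial.comp_smul {c : ℝ} (hc : 0 < c) (h : HasWeakPartial (c • Ω) i u g) :
    HasWeakPartial Ω i (fun x => u (c • x)) (fun x => c • g (c • x)) := by
  refine ⟨?_, fun φ hφ => ?_⟩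
  · exact (memLp_comp_const_smul hc h.1).const_smul c
  -- The test function is transported to `c • Ω`. Both sides of the weak identity acquire the same
  -- Jacobian, which cancels; only the chain-rule factor c survives.
  · have hinv : ContDiff ℝ ∞ fun x => φ (c⁻¹ • x) := hφ.1.comp (by fun_prop)
    have ht : IsTest (c • Ω) fun x => φ (c⁻¹ • x) := by
      have hcs : HasCompactSupport fun x => φ (c⁻¹ • x) :=
        hφ.2.1.comp_homeomorph (Homeomorph.smulOfNeZero c⁻¹ (inv_ne_zero hc.ne'))
      refine ⟨hinv, hcs, ?_⟩
      intro x hx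
      have := tsupport_comp_subset_preimage φ (f := fun x : Eu d => c⁻¹ • x) (by fun_prop) hx
      exact (Set.mem_smul_set_iff_inv_smul_mem₀ hc.ne' _ _).2 (hφ.2.2 this)
    have e := h.2 _ ht
    have e1 := Measure.setIntegral_comp_smul_of_pos volume
      (fun x => partialD i (fun x => φ (c⁻¹ • x)) x • u x) Ω hc
    have e2 := Measure.setIntegral_comp_smul_of_pos volume
      (fun x => φ (c⁻¹ • x) • g x) Ω hc
    rw [e, smul_neg, ← e2] at e1
    simp only [partialD_comp_smul hφ.1, inv_smul_smul₀ hc.ne'] at e1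
    calc _ = c • ∫ x in Ω, (c⁻¹ • partialD i φ x) • u (c • x) := by
          rw [← integral_smul]
          congr 1 with x
          rw [smul_assoc, smul_inv_smul₀ hc.ne']
      _ = _ := by
          rw [e1, smul_neg, ← integral_smul]
          congr 2 with x
          rw [smul_comm]

end WeakDerivatives

/-! ### Mollification commutes with weak derivatives -/

section Mollification

variable {d : ℕ} {u g : Eu d → ℂ} {i : Fin d}

/-- The mollification of `u` by a normed bump function. -/
abbrev mollify (ρ : ContDiffBump (0 : Eu d)) (u : Eu d → ℂ) : Eu d → ℂ :=
  convolution (ρ.normed volume) u (ContinuousLinearMap.lsmul ℝ ℝ) volume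

theorem contDiff_mollify (ρ : ContDiffBump (0 : Eu d)) (hu : MemLp u 2 volume) :
    ContDiff ℝ ∞ (mollify ρ u) :=
  ρ.hasCompactSupport_normed.contDiff_convolution_left _ ρ.contDiff_normed
    (hu.locallyIntegrable (by norm_num))

/-- The derivative falls on the kernel, and y ↦ ρ(x - y) is itself a test function. The sign from
reflecting the kernel cancels the sign in the definition of the weak derivative. -/
theorem partialD_mollify (ρ : ContDiffBump (0 : Eu d)) (hu : MemLp u 2 volume)
    (h : HasWeakPartial Set.univ i u g) : partialD i (mollify ρ u) = mollify ρ g := by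
  have hloc : LocallyIntegrable u volume := hu.locallyIntegrable (by norm_num)
  have hρ : ContDiff ℝ ∞ (ρ.normed volume) := ρ.contDiff_normed
  have hρc : HasCompactSupport (ρ.normed volume) := ρ.hasCompactSupport_normed
  ext x
  have h1 := hρc.hasFDerivAt_convolution_left (ContinuousLinearMap.lsmul ℝ ℝ)
    (hρ.of_le (by simp)) hloc x
  have hex := (hρc.fderiv (𝕜 := ℝ)).convolutionExists_left
    ((ContinuousLinearMap.lsmul ℝ ℝ : ℝ →L[ℝ] ℂ →L[ℝ] ℂ).precompL (Eu d))
    (hρ.continuous_fderiv (by simp)) hloc x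
  have ht : IsTest Set.univ fun y => ρ.normed volume (x - y) :=
    ⟨hρ.comp (by fun_prop), hρc.comp_homeomorph (Homeomorph.subLeft x), Set.subset_univ _⟩
  have e := h.2 _ ht
  simp only [partialD_comp_const_sub hρ, setIntegral_univ, neg_smul, integral_neg, neg_inj] at e
  rw [partialD, h1.fderiv, convolution_def, ContinuousLinearMap.integral_apply hex,
    mollify, convolution_eq_swap]
  refine Eq.trans ?_ e
  rw [← integral_sub_left_eq_self _ volume x]
  simp [partialD]

end Mollification

/-! ### Extending the class of test functions by density -/

section Pairing

variable {d : ℕ} {Ω : Set (Eu d)}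

theorem memLp_conj {α : Type*} [MeasurableSpace α] {μ : Measure α} {p : ℝ≥0∞} {f : α → ℂ}
    (h : MemLp f p μ) : MemLp (fun x => conj (f x)) p μ :=
  h.star

theorem integrable_mul_conj {α : Type*} [MeasurableSpace α] {μ : Measure α} {f g : α → ℂ}
    (hf : MemLp f 2 μ) (hg : MemLp g 2 μ) : Integrable (fun x => f x * conj (g x)) μ :=
  MemLp.integrable_mul hf (memLp_conj hg)

theorem tendsto_integral_mul_conj {α : Type*} [MeasurableSpace α] {μ : Measure α} {F f : α → ℂ}
    {fn : ℕ → α → ℂ} (hF : MemLp F 2 μ) (hf : MemLp f 2 μ) (hfn : ∀ n, MemLp (fn n) 2 μ)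
    (h : Tendsto (fun n => eLpNorm (fun x => fn n x - f x) 2 μ) atTop (𝓝 0)) :
    Tendsto (fun n => ∫ x, F x * conj (fn n x) ∂μ) atTop (𝓝 (∫ x, F x * conj (f x) ∂μ)) := by
  refine tendsto_integral_of_L1' _ (integrable_mul_conj hF hf).1
    (Eventually.of_forall fun n => integrable_mul_conj hF (hfn n)) ?_
  have h1 : Tendsto (fun n => eLpNorm F 2 μ * eLpNorm (fun x => fn n x - f x) 2 μ) atTop (𝓝 0) := by
    simpa using ENNReal.Tendsto.const_mul h (Or.inr hF.eLpNorm_ne_top)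
  refine tendsto_of_tendsto_of_tendsto_of_le_of_le tendsto_const_nhds h1 (fun _ => bot_le)
    fun n => ?_
  have h2 := eLpNorm_smul_le_mul_eLpNorm (p := 2) (q := 2) (r := 1)
    (memLp_conj ((hfn n).sub hf)).1 hF.1
  refine (le_of_eq ?_).trans (h2.trans (le_of_eq ?_))
  · congr 1
    ext x
    simp [mul_sub]
  · congr 1
    refine eLpNorm_congr_norm_ae (Eventually.of_forall fun x => ?_)
    rw [RCLike.norm_conj, Pi.sub_apply]

/-- The sesquilinear pairing of `(F, f)` with a function `ψ` whose gradient is `κ`. -/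
def pairing (Ω : Set (Eu d)) (F : Fin d → Eu d → ℂ) (f ψ : Eu d → ℂ) (κ : Fin d → Eu d → ℂ) : ℂ :=
  ∫ y in Ω, (∑ i, F i y * conj (κ i y)) + f y * conj (ψ y)

variable {F : Fin d → Eu d → ℂ} {f : Eu d → ℂ}

theorem tendsto_pairing {ψ : Eu d → ℂ} {κ : Fin d → Eu d → ℂ} {ψn : ℕ → Eu d → ℂ}
    {κn : ℕ → Fin d → Eu d → ℂ}
    (hF : ∀ i, MemLp (F i) 2 (volume.restrict Ω)) (hf : MemLp f 2 (volume.restrict Ω))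
    (hψ : MemLp ψ 2 (volume.restrict Ω)) (hκ : ∀ i, MemLp (κ i) 2 (volume.restrict Ω))
    (hψn : ∀ n, MemLp (ψn n) 2 (volume.restrict Ω))
    (hκn : ∀ n i, MemLp (κn n i) 2 (volume.restrict Ω))
    (h : Tendsto (fun n => eLpNorm (fun x => ψn n x - ψ x) 2 (volume.restrict Ω)) atTop (𝓝 0))
    (h' : ∀ i, Tendsto (fun n => eLpNorm (fun x => κn n i x - κ i x) 2 (volume.restrict Ω))
      atTop (𝓝 0)) :
    Tendsto (fun n => pairing Ω F f (ψn n) (κn n)) atTop (𝓝 (pairing Ω F f ψ κ)) := by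
  have e : ∀ (ψ : Eu d → ℂ) (κ : Fin d → Eu d → ℂ), MemLp ψ 2 (volume.restrict Ω) →
      (∀ i, MemLp (κ i) 2 (volume.restrict Ω)) → pairing Ω F f ψ κ =
      (∑ i, ∫ y in Ω, F i y * conj (κ i y)) + ∫ y in Ω, f y * conj (ψ y) := by
    intro ψ κ hψ hκ
    rw [pairing, integral_add (integrable_finsetSum _ fun i _ => integrable_mul_conj (hF i) (hκ i))
      (integrable_mul_conj hf hψ),
      integral_finsetSum _ fun i _ => integrable_mul_conj (hF i) (hκ i)]
  rw [e ψ κ hψ hκ]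
  simp_rw [fun n => e (ψn n) (κn n) (hψn n) (hκn n)]
  exact (tendsto_finsetSum _ fun i _ =>
    tendsto_integral_mul_conj (hF i) (hκ i) (fun n => hκn n i) (h' i)).add
    (tendsto_integral_mul_conj hf hψ hψn h)

theorem tendsto_eLpNorm_smul_sub {μ : Measure (Eu d)} {a : Eu d → ℝ} (ha : Continuous a)
    (hc : HasCompactSupport a) {un : ℕ → Eu d → ℂ} {u : Eu d → ℂ}
    (h : Tendsto (fun n => eLpNorm (fun x => un n x - u x) 2 μ) atTop (𝓝 0)) :
    Tendsto (fun n => eLpNorm (fun x => a x • (un n x - u x)) 2 μ) atTop (𝓝 0) := by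
  obtain ⟨C, hC⟩ := ha.bounded_above_of_compact_support hc
  have h1 : Tendsto (fun n => ENNReal.ofReal C * eLpNorm (fun x => un n x - u x) 2 μ)
      atTop (𝓝 0) := by
    simpa using ENNReal.Tendsto.const_mul h (Or.inr ENNReal.ofReal_ne_top)
  refine tendsto_of_tendsto_of_tendsto_of_le_of_le tendsto_const_nhds h1 (fun _ => bot_le)
    fun n => ?_
  refine eLpNorm_le_mul_eLpNorm_of_ae_le_mul (Eventually.of_forall fun x => ?_) 2
  rw [norm_smul]
  gcongr
  exact hC x

theorem memLp_smul {μ : Measure (Eu d)} {a : Eu d → ℝ} (ha : Continuous a)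
    (hc : HasCompactSupport a) {u : Eu d → ℂ} (hu : MemLp u 2 μ) :
    MemLp (fun x => a x • u x) 2 μ :=
  hu.smul (ha.memLp_top_of_hasCompactSupport hc μ)

/-- Orthogonality to test functions extends to cut-offs of functions in `H¹`. -/
theorem pairing_cutoff_eq_zero
    (hF : ∀ i, MemLp (F i) 2 (volume.restrict Ω)) (hf : MemLp f 2 (volume.restrict Ω))
    (horth : ∀ φ : Eu d → ℂ, IsTest Ω φ → pairing Ω F f φ (fun i => partialD i φ) = 0)
    {u : Eu d → ℂ} {g : Fin d → Eu d → ℂ} (hu : MemLp u 2 volume)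
    (hg : ∀ i, HasWeakPartial Set.univ i u (g i)) {χ : Eu d → ℝ} (hχ : IsTest Ω χ) :
    pairing Ω F f (fun x => χ x • u x) (fun i x => χ x • g i x + partialD i χ x • u x) = 0 := by
  have hg2 : ∀ i, MemLp (g i) 2 volume := fun i => by simpa using (hg i).1
  let ρ : ℕ → ContDiffBump (0 : Eu d) := fun n =>
    ⟨1 / ((n : ℝ) + 1) / 2, 1 / ((n : ℝ) + 1), by positivity, half_lt_self (by positivity)⟩
  have hρ : Tendsto (fun n => (ρ n).rOut) atTop (𝓝 0) := tendsto_one_div_add_atTop_nhds_zero_nat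
  have hres : ∀ v : Eu d → ℂ, MemLp v 2 volume → Tendsto (fun n => eLpNorm
      (fun x => mollify (ρ n) v x - v x) 2 (volume.restrict Ω)) atTop (𝓝 0) := fun v hv =>
    tendsto_of_tendsto_of_tendsto_of_le_of_le tendsto_const_nhds
      (tendsto_eLpNorm_convolution_sub hv hρ) (fun _ => bot_le)
      fun n => eLpNorm_mono_measure _ Measure.restrict_le_self
  have hmeas : ∀ v : Eu d → ℂ, MemLp v 2 volume → ∀ n, AEStronglyMeasurable
      (fun x => mollify (ρ n) v x - v x) (volume.restrict Ω) := fun v hv n =>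
    ((contDiff_mollify (ρ n) hv).continuous.aestronglyMeasurable).sub hv.1.restrict
  have hχp := fun i => partialD_continuous hχ.1 i
  have hχpc := fun i => hasCompactSupport_partialD hχ.2.1 i
  -- Cutting off after mollifying keeps the support inside that of χ, so the mollification radius
  -- need not be small relative to the distance to the boundary of Ω.
  have htest : ∀ n, IsTest Ω fun x => χ x • mollify (ρ n) u x := fun n =>
    ⟨hχ.1.smul (contDiff_mollify (ρ n) hu), hχ.2.1.smul_right,
      (tsupport_smul_subset_left _ _).trans hχ.2.2⟩
  have hder : ∀ n i x, partialD i (fun x => χ x • mollify (ρ n) u x) x =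
      χ x • mollify (ρ n) (g i) x + partialD i χ x • mollify (ρ n) u x := fun n i x => by
    rw [partialD_smul hχ.1 (contDiff_mollify (ρ n) hu), partialD_mollify (ρ n) hu (hg i)]
  have hlim := tendsto_pairing (ψn := fun n x => χ x • mollify (ρ n) u x)
    (κn := fun n i => partialD i fun x => χ x • mollify (ρ n) u x)
    (ψ := fun x => χ x • u x) (κ := fun i x => χ x • g i x + partialD i χ x • u x) hF hf
    (memLp_smul hχ.1.continuous hχ.2.1 (hu.restrict Ω))
    (fun i => (memLp_smul hχ.1.continuous hχ.2.1 ((hg2 i).restrict Ω)).add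
      (memLp_smul (hχp i) (hχpc i) (hu.restrict Ω)))
    (fun n => (htest n).1.continuous.memLp_of_hasCompactSupport (htest n).2.1)
    (fun n i => partialD_memLp (htest n).1 (htest n).2.1 i 2 _) ?_ ?_
  · refine tendsto_nhds_unique hlim ?_
    simp_rw [fun n => horth _ (htest n)]
    exact tendsto_const_nhds
  · simp only [← smul_sub]
    exact tendsto_eLpNorm_smul_sub hχ.1.continuous hχ.2.1 (hres u hu)
  · intro i
    have h1 := tendsto_eLpNorm_smul_sub hχ.1.continuous hχ.2.1 (hres _ (hg2 i))
    have h2 := tendsto_eLpNorm_smul_sub (hχp i) (hχpc i) (hres u hu)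
    have h3 := h1.add h2
    rw [add_zero] at h3
    refine tendsto_of_tendsto_of_tendsto_of_le_of_le tendsto_const_nhds h3 (fun _ => bot_le)
      fun n => ?_
    refine le_trans (le_of_eq ?_) (eLpNorm_add_le
      (hχ.1.continuous.aestronglyMeasurable.smul (hmeas _ (hg2 i) n))
      ((hχp i).aestronglyMeasurable.smul (hmeas u hu n)) (by norm_num))
    congr 1
    ext x
    simp only [hder, Pi.add_apply, smul_sub]
    ring

theorem eLpNorm_le_of_integral_le {α : Type*} [MeasurableSpace α] {μ : Measure α} {f : α → ℂ}
    (hf : MemLp f 2 μ) {c : ℝ} (h : ∫ x, ‖f x‖ ^ 2 ∂μ ≤ c) :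
    eLpNorm f 2 μ ≤ ENNReal.ofReal (Real.sqrt c) := by
  rw [hf.eLpNorm_eq_integral_rpow_norm (by simp) (by simp)]
  apply ENNReal.ofReal_le_ofReal
  rw [Real.sqrt_eq_rpow]
  simp only [ENNReal.toReal_ofNat, Real.rpow_ofNat]
  rw [← one_div]
  exact Real.rpow_le_rpow (integral_nonneg fun x => by positivity) h (by norm_num)

/-- Orthogonality to test functions extends to `H¹₀`. -/
theorem pairing_eq_zero_of_memH10 (hΩ : IsOpen Ω)
    (hF : ∀ i, MemLp (F i) 2 (volume.restrict Ω)) (hf : MemLp f 2 (volume.restrict Ω))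
    (horth : ∀ φ : Eu d → ℂ, IsTest Ω φ → pairing Ω F f φ (fun i => partialD i φ) = 0)
    {u : Eu d → ℂ} (hu : MemH10 Ω u) :
    pairing Ω F f u (fun i => weakPartial Ω i u) = 0 := by
  obtain ⟨hu1, φ, hφ, hlim⟩ := hu
  have hφ2 : ∀ n, MemLp (φ n) 2 (volume.restrict Ω) := fun n =>
    (hφ n).1.continuous.memLp_of_hasCompactSupport (hφ n).2.1
  have hwp : ∀ n i, HasWeakPartial Ω i (fun x => u x - φ n x)
      (fun x => weakPartial Ω i u x - partialD i (φ n) x) := fun n i =>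
    (hu1.hasWeakPartial i).sub hu1.1 (hφ2 n) (hasWeakPartial_of_contDiff (hφ n).1 (hφ n).2.1)
  have hnorm : Tendsto (fun n => ENNReal.ofReal (h1Norm Ω fun x => u x - φ n x)) atTop (𝓝 0) := by
    simpa using ENNReal.tendsto_ofReal hlim
  have hnn : ∀ n i, 0 ≤ ∫ x in Ω, ‖weakPartial Ω i (fun x => u x - φ n x) x‖ ^ 2 :=
    fun n i => integral_nonneg fun x => by positivity
  have hlim := tendsto_pairing (ψn := φ) (κn := fun n i => partialD i (φ n)) hF hf hu1.1
    (fun i => (hu1.hasWeakPartial i).1) hφ2 (fun n i => partialD_memLp (hφ n).1 (hφ n).2.1 i 2 _)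
    ?_ ?_
  · refine tendsto_nhds_unique hlim ?_
    simp_rw [fun n => horth _ (hφ n)]
    exact tendsto_const_nhds
  · refine tendsto_of_tendsto_of_tendsto_of_le_of_le tendsto_const_nhds hnorm (fun _ => bot_le)
      fun n => ?_
    refine (le_of_eq (eLpNorm_sub_comm _ _ _ _)).trans
      (eLpNorm_le_of_integral_le (hu1.1.sub (hφ2 n)) ?_)
    exact le_add_of_nonneg_right (Finset.sum_nonneg fun i _ => hnn n i)
  · intro i
    refine tendsto_of_tendsto_of_tendsto_of_le_of_le tendsto_const_nhds hnorm (fun _ => bot_le)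
      fun n => ?_
    refine (le_of_eq (eLpNorm_sub_comm _ _ _ _)).trans
      (eLpNorm_le_of_integral_le (hwp n i).1 ?_)
    -- `h1Norm` involves the chosen weak derivative of the difference, which agrees only almost
    -- everywhere with the difference of the derivatives.
    have e : ∫ x in Ω, ‖(weakPartial Ω i u - partialD i (φ n)) x‖ ^ 2 =
        ∫ x in Ω, ‖weakPartial Ω i (fun x => u x - φ n x) x‖ ^ 2 := by
      refine integral_congr_ae ?_
      filter_upwards [(hwp n i).weakPartial_ae_eq hΩ] with x hx
      rw [hx]
      rfl
    change ∫ x in Ω, ‖(weakPartial Ω i u - partialD i (φ n)) x‖ ^ 2 ≤ _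
    rw [e]
    refine (Finset.single_le_sum (f := fun i => ∫ x in Ω,
      ‖weakPartial Ω i (fun x => u x - φ n x) x‖ ^ 2) (fun i _ => hnn n i)
      (Finset.mem_univ i)).trans ?_
    exact le_add_of_nonneg_left (integral_nonneg fun x => by positivity)

end Pairing

/-! ### Pointwise ellipticity estimates -/

section Ellipticity

variable {d : ℕ}

theorem re_form_eq (A : Matrix (Fin d) (Fin d) ℝ) (ξ : Fin d → ℂ) :
    (∑ i, ∑ j, (A i j : ℂ) * ξ j * conj (ξ i)).re =
      (∑ i, ∑ j, A i j * (ξ j).re * (ξ i).re) + ∑ i, ∑ j, A i j * (ξ j).im * (ξ i).im := by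
  simp only [Complex.re_sum, ← Finset.sum_add_distrib]
  refine Finset.sum_congr rfl fun i _ => Finset.sum_congr rfl fun j _ => ?_
  simp

theorem Matrix.PosDef.sum_nonneg {A : Matrix (Fin d) (Fin d) ℝ} (hA : A.PosDef) (a : Fin d → ℝ) :
    0 ≤ ∑ i, ∑ j, A i j * a j * a i := by
  have := hA.posSemidef.dotProduct_mulVec_nonneg a
  simp only [dotProduct, Matrix.mulVec, star_trivial, Finset.mul_sum] at this
  refine this.trans_eq (Finset.sum_congr rfl fun i _ => Finset.sum_congr rfl fun j _ => by ring)

theorem Matrix.PosDef.sum_pos {A : Matrix (Fin d) (Fin d) ℝ} (hA : A.PosDef) {a : Fin d → ℝ}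
    (ha : a ≠ 0) : 0 < ∑ i, ∑ j, A i j * a j * a i := by
  have := hA.dotProduct_mulVec_pos ha
  simp only [dotProduct, Matrix.mulVec, star_trivial, Finset.mul_sum] at this
  refine this.trans_eq (Finset.sum_congr rfl fun i _ => Finset.sum_congr rfl fun j _ => by ring)

theorem Matrix.PosDef.re_form_pos {A : Matrix (Fin d) (Fin d) ℝ} (hA : A.PosDef) {ξ : Fin d → ℂ}
    (hξ : ξ ≠ 0) : 0 < (∑ i, ∑ j, (A i j : ℂ) * ξ j * conj (ξ i)).re := by
  rw [re_form_eq]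
  by_cases h : (fun i => (ξ i).re) = 0
  · have h' : (fun i => (ξ i).im) ≠ 0 := fun h' =>
      hξ (funext fun i => Complex.ext (congrFun h i) (congrFun h' i))
    exact add_pos_of_nonneg_of_pos (hA.sum_nonneg fun i => (ξ i).re) (hA.sum_pos h')
  · exact add_pos_of_pos_of_nonneg (hA.sum_pos h) (hA.sum_nonneg fun i => (ξ i).im)

theorem Amin_eq (A : Matrix (Fin d) (Fin d) ℝ) :
    Amin A = ⨅ ξ : Metric.sphere (0 : EuclideanSpace ℂ (Fin d)) 1,
      (∑ i, ∑ j, (A i j : ℂ) * ξ.1 j * conj (ξ.1 i)).re := by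
  unfold Amin
  congr with ξ
  congr 1
  exact Finset.sum_congr rfl fun i _ => Finset.sum_congr rfl fun j _ => by ring

/-- The infimum is attained because the unit sphere is compact. `NeZero d` makes the sphere
nonempty; over an empty sphere the real infimum would take the default value 0 and `Amin_pos` would
fail. -/
theorem exists_Amin_eq [NeZero d] (A : Matrix (Fin d) (Fin d) ℝ) :
    ∃ ξ ∈ Metric.sphere (0 : EuclideanSpace ℂ (Fin d)) 1,
      Amin A = (∑ i, ∑ j, (A i j : ℂ) * ξ j * conj (ξ i)).re ∧
      ∀ η ∈ Metric.sphere (0 : EuclideanSpace ℂ (Fin d)) 1,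
        Amin A ≤ (∑ i, ∑ j, (A i j : ℂ) * η j * conj (η i)).re := by
  have hc : Continuous fun ξ : EuclideanSpace ℂ (Fin d) =>
      (∑ i, ∑ j, (A i j : ℂ) * ξ j * conj (ξ i)).re := by
    refine Complex.continuous_re.comp (continuous_finsetSum _ fun i _ =>
      continuous_finsetSum _ fun j _ => ?_)
    refine (continuous_const.mul (by fun_prop)).mul (Complex.continuous_conj.comp (by fun_prop))
  have hne : (Metric.sphere (0 : EuclideanSpace ℂ (Fin d)) 1).Nonempty :=
    ⟨EuclideanSpace.single 0 1, by simp⟩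
  obtain ⟨ξ, hξ, hmin⟩ := (isCompact_sphere (0 : EuclideanSpace ℂ (Fin d)) 1).exists_isMinOn hne
    hc.continuousOn
  have : Nonempty (Metric.sphere (0 : EuclideanSpace ℂ (Fin d)) 1) := ⟨⟨ξ, hξ⟩⟩
  have e : Amin A = (∑ i, ∑ j, (A i j : ℂ) * ξ j * conj (ξ i)).re := by
    rw [Amin_eq]
    refine le_antisymm (ciInf_le
      ⟨(∑ i, ∑ j, (A i j : ℂ) * ξ j * conj (ξ i)).re, ?_⟩ (⟨ξ, hξ⟩ : Metric.sphere _ _))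
      (le_ciInf fun η => hmin η.2)
    rintro _ ⟨η, rfl⟩
    exact hmin η.2
  exact ⟨ξ, hξ, e, fun η hη => e.trans_le (hmin hη)⟩

theorem Amin_pos [NeZero d] {A : Matrix (Fin d) (Fin d) ℝ} (hA : A.PosDef) : 0 < Amin A := by
  obtain ⟨ξ, hξ, e, -⟩ := exists_Amin_eq A
  rw [e]
  refine hA.re_form_pos fun h => ?_
  have : ξ = 0 := by ext i; exact congrFun h i
  simp [this] at hξ

theorem Amin_mul_le [NeZero d] (A : Matrix (Fin d) (Fin d) ℝ) (ξ : Fin d → ℂ) :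
    Amin A * ∑ i, ‖ξ i‖ ^ 2 ≤ (∑ i, ∑ j, (A i j : ℂ) * ξ j * conj (ξ i)).re := by
  obtain ⟨-, -, -, h⟩ := exists_Amin_eq A
  set x : EuclideanSpace ℂ (Fin d) := WithLp.toLp 2 ξ with hx
  have hn : ‖x‖ ^ 2 = ∑ i, ‖ξ i‖ ^ 2 := by rw [EuclideanSpace.norm_sq_eq]
  by_cases h0 : ‖x‖ = 0
  · have hz : ξ = 0 := by
      have : x = 0 := norm_eq_zero.1 h0
      ext i
      exact congrFun (congrArg WithLp.ofLp this) i
    simp [hz]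
  · have := h (((‖x‖⁻¹ : ℝ) : ℂ) • x) (by simp [norm_smul, h0])
    have e : (∑ i, ∑ j, (A i j : ℂ) * (((‖x‖⁻¹ : ℝ) : ℂ) • x) j *
        conj ((((‖x‖⁻¹ : ℝ) : ℂ) • x) i)) =
        ((‖x‖⁻¹ ^ 2 : ℝ) : ℂ) * ∑ i, ∑ j, (A i j : ℂ) * ξ j * conj (ξ i) := by
      simp only [Finset.mul_sum]
      refine Finset.sum_congr rfl fun i _ => Finset.sum_congr rfl fun j _ => ?_
      simp only [PiLp.smul_apply, smul_eq_mul, map_mul, Complex.conj_ofReal, hx]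
      push_cast
      ring
    rw [e, Complex.re_ofReal_mul] at this
    rw [← hn]
    have hp : 0 < ‖x‖ ^ 2 := by positivity
    calc Amin A * ‖x‖ ^ 2 ≤ (‖x‖⁻¹ ^ 2 * _) * ‖x‖ ^ 2 := by gcongr
      _ = _ := by field_simp

/-- Young's inequality with a free weight δ: it becomes the size of the cut-off gradient in the
decay estimate, and a small multiple of the ellipticity constant in the comparison. -/
theorem norm_form_le {M : Matrix (Fin d) (Fin d) ℝ} {K : ℝ} (hM : ∀ i j, |M i j| ≤ K)
    (ξ η : Fin d → ℂ) {δ : ℝ} (hδ : 0 < δ) :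
    ‖∑ i, (∑ j, (M i j : ℂ) * ξ j) * conj (η i)‖ ≤
      K * d / 2 * (δ * (∑ i, ‖ξ i‖ ^ 2) + δ⁻¹ * ∑ i, ‖η i‖ ^ 2) := by
  have key : ∀ i j, ‖(M i j : ℂ) * ξ j * conj (η i)‖ ≤
      K / 2 * (δ * ‖ξ j‖ ^ 2 + δ⁻¹ * ‖η i‖ ^ 2) := fun i j => by
    rw [norm_mul, norm_mul, RCLike.norm_conj, Complex.norm_real, Real.norm_eq_abs]
    have hK : 0 ≤ K := (abs_nonneg _).trans (hM i j)
    have h1 : ‖ξ j‖ * ‖η i‖ ≤ (δ * ‖ξ j‖ ^ 2 + δ⁻¹ * ‖η i‖ ^ 2) / 2 := by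
      have h2 := mul_nonneg (inv_nonneg.2 hδ.le) (sq_nonneg (δ * ‖ξ j‖ - ‖η i‖))
      have h3 : δ⁻¹ * (δ * ‖ξ j‖ - ‖η i‖) ^ 2 =
          δ * ‖ξ j‖ ^ 2 + δ⁻¹ * ‖η i‖ ^ 2 - 2 * (‖ξ j‖ * ‖η i‖) := by
        field_simp
        ring
      linarith
    calc |M i j| * ‖ξ j‖ * ‖η i‖ = |M i j| * (‖ξ j‖ * ‖η i‖) := by ring
      _ ≤ K * ((δ * ‖ξ j‖ ^ 2 + δ⁻¹ * ‖η i‖ ^ 2) / 2) :=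
          mul_le_mul (hM i j) h1 (by positivity) hK
      _ = _ := by ring
  simp only [Finset.sum_mul]
  refine (norm_sum_le _ _).trans ((Finset.sum_le_sum fun i _ => (norm_sum_le _ _).trans
    (Finset.sum_le_sum fun j _ => key i j)).trans (le_of_eq ?_))
  simp only [← Finset.mul_sum, Finset.sum_add_distrib, Finset.sum_const, Finset.card_univ,
    Fintype.card_fin, nsmul_eq_mul]
  ring

/-- The integrand of the form tested with a cut-off of u; z and p are the value and gradient of the
cut-off at a point. The cut-off enters linearly, not squared, so the cross term is not absorbed. It
is only small, of order s: taking δ = s in Young's inequality balances its two parts. -/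
theorem re_cutoff_form_ge [NeZero d] {M : Matrix (Fin d) (Fin d) ℝ} {K c m s z : ℝ}
    (hM : ∀ i j, |M i j| ≤ K)
    (hc : ∀ ξ : Fin d → ℂ, c * ∑ i, ‖ξ i‖ ^ 2 ≤ (∑ i, ∑ j, (M i j : ℂ) * ξ j * conj (ξ i)).re)
    (hm : c ≤ m) (hs : 0 < s) (hz : 0 ≤ z) (u : ℂ) (ξ : Fin d → ℂ) {p : Fin d → ℝ}
    (hp : ∀ i, |p i| ≤ s) :
    c * z * (‖u‖ ^ 2 + ∑ i, ‖ξ i‖ ^ 2) - K * d ^ 2 * s * (‖u‖ ^ 2 + ∑ i, ‖ξ i‖ ^ 2) ≤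
      ((∑ i, (∑ j, (M i j : ℂ) * ξ j) * conj (z • ξ i + p i • u)) +
        m * u * conj (z • u)).re := by
  have hK : 0 ≤ K := (abs_nonneg _).trans (hM 0 0)
  have hd : (1 : ℝ) ≤ d := by exact_mod_cast NeZero.one_le
  set X := ∑ i, ‖ξ i‖ ^ 2 with hX
  have hX0 : 0 ≤ X := Finset.sum_nonneg fun i _ => by positivity
  have h1 := norm_form_le hM ξ (fun i => p i • u) hs
  have h2 : ∑ i, ‖p i • u‖ ^ 2 ≤ d * (s ^ 2 * ‖u‖ ^ 2) := by
    refine (Finset.sum_le_card_nsmul _ _ (s ^ 2 * ‖u‖ ^ 2) fun i _ => ?_).trans (by simp)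
    rw [norm_smul, mul_pow, Real.norm_eq_abs]
    have := hp i
    gcongr
  have e : (∑ i, (∑ j, (M i j : ℂ) * ξ j) * conj (z • ξ i + p i • u)) =
      z * (∑ i, ∑ j, (M i j : ℂ) * ξ j * conj (ξ i)) +
        ∑ i, (∑ j, (M i j : ℂ) * ξ j) * conj (p i • u) := by
    rw [Finset.mul_sum, ← Finset.sum_add_distrib]
    refine Finset.sum_congr rfl fun i _ => ?_
    rw [← Finset.sum_mul]
    simp only [Complex.real_smul, map_add, map_mul, Complex.conj_ofReal]
    ring
  have e2 : ((m : ℂ) * u * conj (z • u)).re = z * (m * ‖u‖ ^ 2) := by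
    have : (m : ℂ) * u * conj (z • u) = ((z * (m * ‖u‖ ^ 2) : ℝ) : ℂ) := by
      push_cast
      rw [← Complex.mul_conj']
      simp only [Complex.real_smul, map_mul, Complex.conj_ofReal]
      ring
    rw [this, Complex.ofReal_re]
  rw [e, Complex.add_re, Complex.add_re, e2, Complex.re_ofReal_mul]
  have h3 := (abs_le.1 ((Complex.abs_re_le_norm _).trans h1)).1
  have h4 := mul_le_mul_of_nonneg_left (hc ξ) hz
  have h5 : z * (c * ‖u‖ ^ 2) ≤ z * (m * ‖u‖ ^ 2) := by gcongr
  have h6 : K * d / 2 * (s * X + s⁻¹ * ∑ i, ‖p i • u‖ ^ 2) ≤ K * d ^ 2 * s * (‖u‖ ^ 2 + X) := by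
    calc _ ≤ K * d / 2 * (s * X + s⁻¹ * (d * (s ^ 2 * ‖u‖ ^ 2))) := by gcongr
      _ = K * d / 2 * s * (X + d * ‖u‖ ^ 2) := by field_simp
      _ ≤ K * d / 2 * s * (d * X + d * ‖u‖ ^ 2) := by
          gcongr
          exact le_mul_of_one_le_left hX0 hd
      _ = K * d ^ 2 * s * (‖u‖ ^ 2 + X) / 2 := by ring
      _ ≤ _ := half_le_self (by positivity)
  linarith

/-- The pointwise form of Céa's argument: the cross terms between (v, ξ) and the perturbation (ψ, κ)
use up half of the coercivity, and the rest is charged to the perturbation. -/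
theorem re_perturbed_form_ge {M : Matrix (Fin d) (Fin d) ℝ} {K c m : ℝ}
    (hM : ∀ i j, |M i j| ≤ K) (hK : 0 < K)
    (hc : ∀ ξ : Fin d → ℂ, c * ∑ i, ‖ξ i‖ ^ 2 ≤ (∑ i, ∑ j, (M i j : ℂ) * ξ j * conj (ξ i)).re)
    (hm : c ≤ m) (hc0 : 0 < c) (v ψ : ℂ) (ξ κ : Fin d → ℂ) :
    c / 2 * (‖v‖ ^ 2 + ∑ i, ‖ξ i‖ ^ 2) - 2 * (K * d + m) ^ 2 / c * (‖ψ‖ ^ 2 + ∑ i, ‖κ i‖ ^ 2) ≤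
      ((∑ i, (∑ j, (M i j : ℂ) * ξ j) * conj (ξ i + κ i)) + m * v * conj (v + ψ)).re := by
  have hm0 : 0 < m := hc0.trans_le hm
  set C := K * d + m with hC
  have hC0 : 0 < C := by positivity
  set X := ∑ i, ‖ξ i‖ ^ 2 with hX
  set Y := ∑ i, ‖κ i‖ ^ 2 with hY
  have hX0 : 0 ≤ X := Finset.sum_nonneg fun i _ => by positivity
  have hY0 : 0 ≤ Y := Finset.sum_nonneg fun i _ => by positivity
  -- Chosen so that C δ = c / 2, the half of the coercivity to be given up; then C / δ = 2 C² / c.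
  set δ := c / (2 * C) with hδ
  have hδ0 : 0 < δ := by positivity
  have h1 := norm_form_le hM ξ κ hδ0
  -- The zeroth-order cross term is the same estimate for a 1 × 1 matrix.
  have h1' := norm_form_le (d := 1) (M := fun _ _ => m) (K := m)
    (fun _ _ => (abs_of_pos hm0).le) (fun _ => v) (fun _ => ψ) hδ0
  simp only [Finset.univ_unique, Finset.sum_singleton, Nat.cast_one, mul_one] at h1'
  have e : (∑ i, (∑ j, (M i j : ℂ) * ξ j) * conj (ξ i + κ i)) =
      (∑ i, ∑ j, (M i j : ℂ) * ξ j * conj (ξ i)) +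
        ∑ i, (∑ j, (M i j : ℂ) * ξ j) * conj (κ i) := by
    rw [← Finset.sum_add_distrib]
    refine Finset.sum_congr rfl fun i _ => ?_
    rw [← Finset.sum_mul, map_add, mul_add]
  have e2 : (m : ℂ) * v * conj (v + ψ) = ((m * ‖v‖ ^ 2 : ℝ) : ℂ) + m * v * conj ψ := by
    push_cast
    rw [← Complex.mul_conj', map_add]
    ring
  rw [e, e2, Complex.add_re, Complex.add_re, Complex.add_re, Complex.ofReal_re]
  have h3 := (abs_le.1 ((Complex.abs_re_le_norm _).trans h1)).1
  have h3' := (abs_le.1 ((Complex.abs_re_le_norm _).trans h1')).1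
  have h4 := hc ξ
  have h5 : c * ‖v‖ ^ 2 ≤ m * ‖v‖ ^ 2 := by gcongr
  have h6 : K * d / 2 * (δ * X + δ⁻¹ * Y) ≤ C * (δ * X + δ⁻¹ * Y) := by
    gcongr
    have : 0 ≤ K * d := by positivity
    linarith
  have h7 : m / 2 * (δ * ‖v‖ ^ 2 + δ⁻¹ * ‖ψ‖ ^ 2) ≤ C * (δ * ‖v‖ ^ 2 + δ⁻¹ * ‖ψ‖ ^ 2) := by
    gcongr
    have : 0 ≤ K * d := by positivity
    linarith
  have h8 : C * (δ * X + δ⁻¹ * Y) + C * (δ * ‖v‖ ^ 2 + δ⁻¹ * ‖ψ‖ ^ 2) =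
      c / 2 * (‖v‖ ^ 2 + X) + 2 * C ^ 2 / c * (‖ψ‖ ^ 2 + Y) := by
    rw [hδ]
    field_simp
    ring
  linarith

end Ellipticity

/-! ### Cut-off functions at scale R -/

section Cutoff

variable {d : ℕ}

/-- All cut-offs are dilations of a single bump, so one constant L serves every R; the chain rule
supplies the factor 1 / R. -/
theorem exists_cutoff (d : ℕ) : ∃ L : ℝ, 0 < L ∧ ∀ R : ℝ, 0 < R → ∃ β : Eu d → ℝ,
    IsTest Set.univ β ∧ tsupport β ⊆ Metric.closedBall 0 (2 * R) ∧ (∀ y, 0 ≤ β y ∧ β y ≤ 1) ∧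
    (∀ y, ‖y‖ ≤ R → β y = 1) ∧ (∀ y, 2 * R ≤ ‖y‖ → β y = 0) ∧ (∀ i y, |partialD i β y| ≤ L / R) ∧
    ∀ i y, ‖y‖ < R → partialD i β y = 0 := by
  let b : ContDiffBump (0 : Eu d) := ⟨1, 2, one_pos, one_lt_two⟩
  have hb : ContDiff ℝ ∞ b := b.contDiff
  obtain ⟨L, hL⟩ := (hb.continuous_fderiv (by simp)).bounded_above_of_compact_support
    (b.hasCompactSupport.fderiv (𝕜 := ℝ))
  refine ⟨max L 1, by positivity, fun R hR => ⟨fun y => b (R⁻¹ • y),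
    ⟨hb.comp (by fun_prop), b.hasCompactSupport.comp_homeomorph
      (Homeomorph.smulOfNeZero R⁻¹ (inv_ne_zero hR.ne')), Set.subset_univ _⟩,
    ?_, fun y => ⟨b.nonneg, b.le_one⟩, ?_, ?_, ?_, ?_⟩⟩
  · intro y hy
    have h := tsupport_comp_subset_preimage b (f := fun y : Eu d => R⁻¹ • y) (by fun_prop) hy
    rw [Set.mem_preimage, b.tsupport_eq, mem_closedBall_zero_iff, norm_smul, norm_inv,
      Real.norm_of_nonneg hR.le, inv_mul_le_iff₀ hR] at h
    rw [mem_closedBall_zero_iff, mul_comm]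
    exact h
  · intro y hy
    apply b.one_of_mem_closedBall
    rw [mem_closedBall_zero_iff, norm_smul, norm_inv, Real.norm_of_nonneg hR.le,
      inv_mul_le_iff₀ hR]
    simpa [b] using hy
  · intro y hy
    apply b.zero_of_le_dist
    rw [dist_zero_right, norm_smul, norm_inv, Real.norm_of_nonneg hR.le, le_inv_mul_iff₀ hR,
      mul_comm]
    exact hy
  · intro i y
    rw [partialD_comp_smul hb, smul_eq_mul, abs_mul, abs_of_pos (inv_pos.2 hR), div_eq_inv_mul]
    gcongr
    refine ((fderiv ℝ b (R⁻¹ • y)).le_opNorm _).trans ?_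
    rw [PiLp.norm_single, norm_one, mul_one]
    exact (hL _).trans (le_max_left _ _)
  · intro i y hy
    have : (fun y : Eu d => b (R⁻¹ • y)) =ᶠ[𝓝 y] fun _ => 1 := by
      filter_upwards [continuous_norm.continuousAt.eventually (gt_mem_nhds hy)] with z hz
      apply b.one_of_mem_closedBall
      rw [mem_closedBall_zero_iff, norm_smul, norm_inv, Real.norm_of_nonneg hR.le,
        inv_mul_le_iff₀ hR]
      simpa [b] using hz.le
    simp [partialD, this.fderiv_eq]

end Cutoff

/-! ### Fluxes, energy density and uniform ellipticity -/

section Flux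

variable {d : ℕ} {Ω Ω' : Set (Eu d)} {A A₁ : Matrix (Fin d) (Fin d) ℝ} {B : Set (Eu d)}

/-- The flux `Ã g` of a vector field `g`. -/
def flux (A A₁ : Matrix (Fin d) (Fin d) ℝ) (B : Set (Eu d)) (g : Fin d → Eu d → ℂ) (i : Fin d)
    (y : Eu d) : ℂ :=
  ∑ j, (coeff A A₁ B y i j : ℂ) * g j y

/-- The density of the `H¹` energy. -/
def energyDensity (u : Eu d → ℂ) (g : Fin d → Eu d → ℂ) (y : Eu d) : ℝ :=
  ‖u y‖ ^ 2 + ∑ i, ‖g i y‖ ^ 2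

theorem energyDensity_nonneg (u : Eu d → ℂ) (g : Fin d → Eu d → ℂ) (y : Eu d) :
    0 ≤ energyDensity u g y :=
  add_nonneg (by positivity) (Finset.sum_nonneg fun i _ => by positivity)

theorem integrable_energyDensity {μ : Measure (Eu d)} {u : Eu d → ℂ} {g : Fin d → Eu d → ℂ}
    (hu : MemLp u 2 μ) (hg : ∀ i, MemLp (g i) 2 μ) : Integrable (energyDensity u g) μ := by
  refine (hu.integrable_norm_pow (by simp)).add
    (integrable_finsetSum _ fun i _ => (hg i).integrable_norm_pow (by simp))

theorem correctorForm_eq_pairing (u φ : Eu d → ℂ) :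
    correctorForm A A₁ B Ω u φ = pairing Ω (flux A A₁ B fun j => weakPartial Ω j u)
      (fun y => Amin A * u y) φ fun i => partialD i φ := by
  simp only [correctorForm, pairing, flux, Finset.sum_mul]

/-- Lets the whole-space equation be read on a smaller domain. -/
theorem pairing_of_isTest {φ : Eu d → ℂ} (h : IsTest Ω φ) (hs : Ω ⊆ Ω')
    (F : Fin d → Eu d → ℂ) (f : Eu d → ℂ) :
    pairing Ω' F f φ (fun i => partialD i φ) = pairing Ω F f φ fun i => partialD i φ := by
  rw [pairing, pairing, setIntegral_eq_integral_of_forall_compl_eq_zero (s := Ω),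
    setIntegral_eq_integral_of_forall_compl_eq_zero]
  · intro x hx
    simp [h.eq_zero fun h' => hx (hs h'), fun i => h.partialD_eq_zero i fun h' => hx (hs h')]
  · intro x hx
    simp [h.eq_zero hx, fun i => h.partialD_eq_zero i hx]

/-- The constant c is the smaller of the two least eigenvalues, so it also bounds the zeroth-order
coefficient `Amin A` from below and a single constant controls the full H¹ energy. -/
theorem exists_ellipticity [NeZero d] (hA : A.PosDef) (hA₁ : A₁.PosDef) (B : Set (Eu d)) :
    ∃ c K : ℝ, 0 < c ∧ 0 < K ∧ c ≤ Amin A ∧ ∀ y, (∀ i j, |coeff A A₁ B y i j| ≤ K) ∧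
      ∀ ξ : Fin d → ℂ, c * ∑ i, ‖ξ i‖ ^ 2 ≤
        (∑ i, ∑ j, (coeff A A₁ B y i j : ℂ) * ξ j * conj (ξ i)).re := by
  have hbd : ∀ M : Matrix (Fin d) (Fin d) ℝ, ∀ i j, |M i j| ≤ ∑ i, ∑ j, |M i j| := fun M i j =>
    (Finset.single_le_sum (f := fun j => |M i j|) (fun _ _ => abs_nonneg _)
      (Finset.mem_univ j)).trans (Finset.single_le_sum (f := fun i => ∑ j, |M i j|)
        (fun _ _ => Finset.sum_nonneg fun _ _ => abs_nonneg _) (Finset.mem_univ i))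
  have hnn : ∀ M : Matrix (Fin d) (Fin d) ℝ, 0 ≤ ∑ i, ∑ j, |M i j| := fun M =>
    Finset.sum_nonneg fun _ _ => Finset.sum_nonneg fun _ _ => abs_nonneg _
  refine ⟨min (Amin A) (Amin A₁), (∑ i, ∑ j, |A i j|) + (∑ i, ∑ j, |A₁ i j|) + 1,
    lt_min (Amin_pos hA) (Amin_pos hA₁), by have := hnn A; have := hnn A₁; linarith,
    min_le_left _ _, fun y => ?_⟩
  unfold coeff
  split_ifs
  · refine ⟨fun i j => (hbd A₁ i j).trans (by linarith [hnn A]), fun ξ => ?_⟩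
    refine le_trans ?_ (Amin_mul_le A₁ ξ)
    gcongr
    exact min_le_right _ _
  · refine ⟨fun i j => (hbd A i j).trans (by linarith [hnn A₁]), fun ξ => ?_⟩
    refine le_trans ?_ (Amin_mul_le A ξ)
    gcongr
    exact min_le_left _ _

theorem memLp_flux {μ : Measure (Eu d)} (hB : MeasurableSet B) {g : Fin d → Eu d → ℂ}
    (hg : ∀ i, MemLp (g i) 2 μ) (i : Fin d) : MemLp (flux A A₁ B g i) 2 μ := by
  refine memLp_finsetSum _ fun j _ => ?_
  have hm : Measurable fun y => (coeff A A₁ B y i j : ℂ) := by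
    have : (fun y => (coeff A A₁ B y i j : ℂ)) =
        fun y => (@ite _ (y ∈ B) (Classical.propDecidable _) (A₁ i j : ℂ) (A i j : ℂ)) := by
      ext y
      unfold coeff
      split_ifs <;> rfl
    rw [this]
    exact Measurable.ite hB measurable_const measurable_const
  refine (hg j).of_le_mul (c := |A i j| + |A₁ i j|) (hm.aestronglyMeasurable.mul (hg j).1)
    (Eventually.of_forall fun y => ?_)
  rw [norm_mul, Complex.norm_real, Real.norm_eq_abs]
  gcongr
  unfold coeff
  split_ifs
  · exact le_add_of_nonneg_left (abs_nonneg _)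
  · exact le_add_of_nonneg_right (abs_nonneg _)

theorem flux_sub (g g' : Fin d → Eu d → ℂ) (i : Fin d) (y : Eu d) :
    flux A A₁ B (fun i y => g i y - g' i y) i y = flux A A₁ B g i y - flux A A₁ B g' i y := by
  simp only [flux, mul_sub, Finset.sum_sub_distrib]

theorem integrable_pairing {F κ : Fin d → Eu d → ℂ} {f ψ : Eu d → ℂ} {μ : Measure (Eu d)}
    (hF : ∀ i, MemLp (F i) 2 μ) (hf : MemLp f 2 μ)
    (hψ : MemLp ψ 2 μ) (hκ : ∀ i, MemLp (κ i) 2 μ) :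
    Integrable (fun y => (∑ i, F i y * conj (κ i y)) + f y * conj (ψ y)) μ :=
  (integrable_finsetSum _ fun i _ => integrable_mul_conj (hF i) (hκ i)).add
    (integrable_mul_conj hf hψ)

theorem memLp_cutoff_partial {μ : Measure (Eu d)} [IsFiniteMeasureOnCompacts μ] {χ : Eu d → ℝ}
    (hχ : IsTest Set.univ χ)
    {u : Eu d → ℂ} {g : Fin d → Eu d → ℂ} (hu : MemLp u 2 μ) (hg : ∀ i, MemLp (g i) 2 μ)
    (i : Fin d) : MemLp (fun x => χ x • g i x + partialD i χ x • u x) 2 μ :=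
  (memLp_smul hχ.1.continuous hχ.2.1 (hg i)).add
    (memLp_smul (partialD_continuous hχ.1 i) (hasCompactSupport_partialD hχ.2.1 i) hu)

end Flux

/-! ### Energy decay between R and 2R -/

section Decay

variable {d : ℕ} {A A₁ : Matrix (Fin d) (Fin d) ℝ} {B : Set (Eu d)}

/-- The complement of a centered ball. -/
def tailSet (d : ℕ) (R : ℝ) : Set (Eu d) := {y | R ≤ ‖y‖}

theorem isClosed_tailSet (R : ℝ) : IsClosed (tailSet d R) :=
  isClosed_le continuous_const continuous_norm

/-- Testing the homogeneous equation with ζu gives 0. Coercivity bounds this below by c times the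
energy where ζ = 1, minus an error of order |∇ζ| ~ 1/R times the energy where |y| ≥ R. The outer
radius M is there only because test functions need compact support; the constant does not depend on
it. -/
theorem energy_shell_le [NeZero d] (hA : A.PosDef) (hA₁ : A₁.PosDef) (hB : MeasurableSet B)
    {u : Eu d → ℂ} {g : Fin d → Eu d → ℂ} {r : ℝ} (hr : 0 < r) (hu : MemLp u 2 volume)
    (hg : ∀ i, HasWeakPartial Set.univ i u (g i))
    (horth : ∀ φ : Eu d → ℂ, IsTest (Metric.closedBall 0 r)ᶜ φ →
      pairing (Metric.closedBall 0 r)ᶜ (flux A A₁ B g) (fun y => Amin A * u y) φ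
        (fun i => partialD i φ) = 0) :
    ∃ C : ℝ, 0 < C ∧ ∀ R M, r < R → R ≤ M →
      ∫ y in tailSet d (2 * R) ∩ Metric.closedBall 0 M, energyDensity u g y ≤
        C / R * ∫ y in tailSet d R, energyDensity u g y := by
  obtain ⟨c, K, hc, hK, hcA, hell⟩ := exists_ellipticity hA hA₁ B
  obtain ⟨L, hL, hcut⟩ := exists_cutoff d
  have hg2 : ∀ i, MemLp (g i) 2 volume := fun i => by simpa using (hg i).1
  have hd : (0 : ℝ) < d := by exact_mod_cast Nat.pos_of_neZero d
  refine ⟨K * d ^ 2 * (2 * L) / c, by positivity, fun R M hR hM => ?_⟩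
  have hR0 : 0 < R := hr.trans hR
  have hM0 : 0 < M := hR0.trans_le hM
  obtain ⟨β, hβ, hβs, hβ01, hβ1, hβz, hβL, hβ0⟩ := hcut R hR0
  obtain ⟨γ, hγ, -, hγ01, hγ1, -, hγL, -⟩ := hcut M hM0
  set Ω : Set (Eu d) := (Metric.closedBall 0 r)ᶜ with hΩ
  have hs : tailSet d R ⊆ Ω := by
    intro y hy
    rw [hΩ, Set.mem_compl_iff, mem_closedBall_zero_iff, not_le]
    exact hR.trans_le hy
  have hs2 : tailSet d (2 * R) ∩ Metric.closedBall 0 M ⊆ Ω := by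
    intro y hy
    exact hs (le_trans (by linarith : R ≤ 2 * R) hy.1)
  -- The factor 1 - β removes the ball of radius R, and γ truncates at distance M. As r < R, the
  -- closed support of ζ avoids the ball of radius r, where the equation is not assumed.
  set ζ : Eu d → ℝ := fun y => (1 - β y) * γ y with hζ
  have hζ0 : ∀ y, ‖y‖ ≤ R → ζ y = 0 := fun y hy => by simp [hζ, hβ1 y hy]
  have hζc : ContDiff ℝ ∞ ζ := (contDiff_const.sub hβ.1).mul hγ.1
  have hζcs : HasCompactSupport ζ := hγ.2.1.mul_left
  have hζs : tsupport ζ ⊆ tailSet d R := by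
    refine closure_minimal ?_ (isClosed_tailSet R)
    intro y hy
    by_contra h
    exact hy (hζ0 y (not_le.1 h).le)
  have hζt : IsTest Ω ζ := ⟨hζc, hζcs, hζs.trans hs⟩
  -- The product rule gives L / R from β and L / M ≤ L / R from γ.
  set s : ℝ := 2 * L / R with hsdef
  have hs0 : 0 < s := by positivity
  have hp : ∀ i y, |partialD i ζ y| ≤ s := by
    intro i y
    have h1 : partialD i ζ y = (1 - β y) * partialD i γ y - partialD i β y * γ y := by
      have := partialD_smul (contDiff_const.sub hβ.1 : ContDiff ℝ ∞ fun y => 1 - β y) hγ.1 i y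
      have h2 : partialD i (fun y => 1 - β y) y = -partialD i β y := by
        simp [partialD, fderiv_const_sub]
      rw [h2] at this
      simp only [smul_eq_mul] at this
      rw [hζ, this]
      ring
    have h3 : |partialD i γ y| ≤ L / R := (hγL i y).trans (by gcongr)
    rw [h1]
    calc _ ≤ |(1 - β y) * partialD i γ y| + |partialD i β y * γ y| := abs_sub _ _
      _ ≤ 1 * (L / R) + (L / R) * 1 := by
        rw [abs_mul, abs_mul]
        have h4 : |1 - β y| ≤ 1 := abs_le.2 ⟨by linarith [(hβ01 y).2], by linarith [(hβ01 y).1]⟩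
        have h5 : |γ y| ≤ 1 := abs_le.2 ⟨by linarith [(hγ01 y).1], (hγ01 y).2⟩
        have := hβL i y
        gcongr
      _ = s := by rw [hsdef]; ring
  have hzero := pairing_cutoff_eq_zero (memLp_flux hB fun i => (hg2 i).restrict Ω)
    ((hu.restrict Ω).const_mul (Amin A : ℂ)) horth hu hg hζt
  have hint := integrable_pairing (μ := volume.restrict Ω)
    (memLp_flux (A := A) (A₁ := A₁) hB fun i => (hg2 i).restrict Ω)
    ((hu.restrict Ω).const_mul (Amin A : ℂ))
    (memLp_smul hζc.continuous hζcs (hu.restrict Ω))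
    (memLp_cutoff_partial (hζt.mono (Set.subset_univ _)) (hu.restrict Ω)
      fun i => (hg2 i).restrict Ω)
  have he : Integrable (energyDensity u g) (volume.restrict Ω) :=
    (integrable_energyDensity hu hg2).restrict
  have hm1 : MeasurableSet (tailSet d (2 * R) ∩ Metric.closedBall 0 M) :=
    (isClosed_tailSet _).measurableSet.inter Metric.isClosed_closedBall.measurableSet
  have hm2 : MeasurableSet (tailSet d R) := (isClosed_tailSet _).measurableSet
  have hpt : ∀ y, c * (tailSet d (2 * R) ∩ Metric.closedBall 0 M).indicator (energyDensity u g) y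
      - K * d ^ 2 * s * (tailSet d R).indicator (energyDensity u g) y ≤
      ((∑ i, flux A A₁ B g i y * conj (ζ y • g i y + partialD i ζ y • u y)) +
        (Amin A * u y) * conj (ζ y • u y)).re := by
    intro y
    have hζnn : ∀ y, 0 ≤ ζ y := fun y =>
      mul_nonneg (by linarith [(hβ01 y).2]) (hγ01 y).1
    have hen := energyDensity_nonneg u g y
    by_cases hy : R ≤ ‖y‖
    · refine le_trans ?_ (re_cutoff_form_ge (hell y).1 (hell y).2 hcA hs0 (hζnn y) (u y)
        (fun i => g i y) (fun i => hp i y))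
      rw [Set.indicator_of_mem (show y ∈ tailSet d R from hy)]
      refine sub_le_sub_right ?_ _
      rw [mul_assoc]
      refine mul_le_mul_of_nonneg_left ?_ hc.le
      by_cases hy2 : y ∈ tailSet d (2 * R) ∩ Metric.closedBall 0 M
      · rw [Set.indicator_of_mem hy2]
        have : ζ y = 1 := by
          simp only [hζ, hβz y hy2.1, hγ1 y (mem_closedBall_zero_iff.1 hy2.2)]
          norm_num
        rw [this, one_mul]
        rfl
      · rw [Set.indicator_of_notMem hy2]
        exact mul_nonneg (hζnn y) hen
    · have h1 : ζ y = 0 := hζ0 y (not_le.1 hy).le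
      have h2 : ∀ i, partialD i ζ y = 0 := fun i =>
        image_eq_zero_of_notMem_tsupport fun h => hy (hζs (tsupport_partialD_subset i ζ h))
      rw [Set.indicator_of_notMem (show y ∉ tailSet d R from hy), Set.indicator_of_notMem]
      · simp [h1, h2]
      · exact fun h => hy (le_trans (by linarith) h.1)
  have hre : ∫ y in Ω, ((∑ i, flux A A₁ B g i y * conj (ζ y • g i y + partialD i ζ y • u y)) +
        (Amin A * u y) * conj (ζ y • u y)).re = 0 := by
    have := integral_re hint
    rw [pairing] at hzero
    rw [hzero] at this
    simpa using this
  have hmain := integral_mono (((he.indicator hm1).const_mul c).sub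
    ((he.indicator hm2).const_mul (K * d ^ 2 * s))) hint.re hpt
  have hre' : ∫ y in Ω, RCLike.re ((∑ i, flux A A₁ B g i y *
      conj (ζ y • g i y + partialD i ζ y • u y)) + (Amin A * u y) * conj (ζ y • u y)) = 0 := hre
  rw [hre'] at hmain
  simp only [Pi.sub_apply] at hmain
  rw [integral_sub ((he.indicator hm1).const_mul c) ((he.indicator hm2).const_mul _),
    integral_const_mul, integral_const_mul, setIntegral_indicator hm1, setIntegral_indicator hm2,
    Set.inter_eq_self_of_subset_right hs, Set.inter_eq_self_of_subset_right hs2] at hmain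
  have e : K * d ^ 2 * (2 * L) / c / R = (K * d ^ 2 * s) / c := by
    rw [hsdef]
    field_simp
  rw [e, div_mul_eq_mul_div, le_div_iff₀ hc]
  linarith

end Decay

/-! ### From doubling to decay of every polynomial order -/

section TailDecay

variable {d : ℕ} {A A₁ : Matrix (Fin d) (Fin d) ℝ} {B : Set (Eu d)}

theorem tail_energy_doubling {f : Eu d → ℝ} (hf : Integrable f volume) {r C : ℝ} (hr : 0 < r)
    (h : ∀ R M, r < R → R ≤ M → ∫ y in tailSet d (2 * R) ∩ Metric.closedBall 0 M, f y ≤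
      C / R * ∫ y in tailSet d R, f y) {R : ℝ} (hR : r < R) :
    ∫ y in tailSet d (2 * R), f y ≤ C / R * ∫ y in tailSet d R, f y := by
  have hU : tailSet d (2 * R) = ⋃ n : ℕ, tailSet d (2 * R) ∩ Metric.closedBall 0 (R + n) := by
    rw [← Set.inter_iUnion]
    refine (Set.inter_eq_left.2 fun y _ => ?_).symm
    obtain ⟨n, hn⟩ := exists_nat_ge ‖y‖
    refine Set.mem_iUnion.2 ⟨n, mem_closedBall_zero_iff.2 ?_⟩
    linarith [hr.trans hR]
  have hlim := tendsto_setIntegral_of_monotone (μ := volume) (f := f)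
    (s := fun n : ℕ => tailSet d (2 * R) ∩ Metric.closedBall 0 (R + n))
    (fun n => (isClosed_tailSet _).measurableSet.inter Metric.isClosed_closedBall.measurableSet)
    (fun m n hmn => Set.inter_subset_inter_right _ (Metric.closedBall_subset_closedBall
      (by have : (m : ℝ) ≤ n := by exact_mod_cast hmn
          linarith)))
    hf.integrableOn
  rw [← hU] at hlim
  exact le_of_tendsto hlim (Eventually.of_forall fun n =>
    h R (R + n) hR (le_add_of_nonneg_right n.cast_nonneg))

/-- A tail that shrinks by a factor `C / R` under doubling decays faster than any power. -/
theorem exists_le_div_pow_of_doubling {E : ℝ → ℝ} {r C E₀ : ℝ} (hr : 0 < r) (hC : 0 < C)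
    (hE₀ : 0 ≤ E₀) (hE : ∀ R, E R ≤ E₀)
    (h : ∀ R, r < R → E (2 * R) ≤ C / R * E R) (k : ℕ) :
    ∃ C' : ℝ, 0 ≤ C' ∧ ∀ R, 2 ^ k * r < R → E R ≤ C' / R ^ k := by
  induction k with
  | zero => exact ⟨E₀, hE₀, fun R _ => by simpa using hE R⟩
  | succ k ih =>
    obtain ⟨C', hC', ih⟩ := ih
    -- Applying the doubling bound and then the induction hypothesis at R / 2 yields C / (R / 2) ·
    -- C' / (R / 2)^k; the factors 2 collect to 2^(k+1).
    refine ⟨2 ^ (k + 1) * C * C', by positivity, fun R hR => ?_⟩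
    have h2 : 2 ^ k * r < R / 2 := by
      rw [lt_div_iff₀ two_pos]
      linarith [pow_succ (2 : ℝ) k, show 2 ^ (k + 1) * r = 2 ^ k * r * 2 by ring]
    have h1 : r ≤ 2 ^ k * r := le_mul_of_one_le_left hr.le (one_le_pow₀ one_le_two)
    have hR0 : 0 < R := by linarith
    have h3 := h (R / 2) (h1.trans_lt h2)
    rw [mul_div_cancel₀ R two_ne_zero] at h3
    calc E R ≤ C / (R / 2) * E (R / 2) := h3
      _ ≤ C / (R / 2) * (C' / (R / 2) ^ k) := by
          gcongr
          exact ih _ h2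
      _ = _ := by
          rw [div_pow]
          field_simp
          ring

end TailDecay

/-! ### Comparison of the two correctors -/

section Comparison

variable {d : ℕ} {A A₁ : Matrix (Fin d) (Fin d) ℝ} {B : Set (Eu d)}

/-- The left side is the H¹ density of (1 - β)w, with its gradient written out by the product rule.
-/
theorem energyDensity_cutoff_le {β : Eu d → ℝ} {L : ℝ} {y : Eu d} (h0 : 0 ≤ β y) (h1 : β y ≤ 1)
    (hL : ∀ i, |partialD i β y| ≤ L) (w : Eu d → ℂ) (g : Fin d → Eu d → ℂ) :
    ‖(1 - β y) • w y‖ ^ 2 + ∑ i, ‖(1 - β y) • g i y - partialD i β y • w y‖ ^ 2 ≤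
      (2 + 2 * d * L ^ 2) * energyDensity w g y := by
  have hb : |1 - β y| ≤ 1 := abs_le.2 ⟨by linarith, by linarith⟩
  have hw : ‖(1 - β y) • w y‖ ^ 2 ≤ ‖w y‖ ^ 2 := by
    rw [norm_smul, Real.norm_eq_abs]
    gcongr
    exact mul_le_of_le_one_left (norm_nonneg _) hb
  have hg : ∀ i, ‖(1 - β y) • g i y - partialD i β y • w y‖ ^ 2 ≤
      2 * ‖g i y‖ ^ 2 + 2 * L ^ 2 * ‖w y‖ ^ 2 := fun i => by
    have h2 : ‖(1 - β y) • g i y - partialD i β y • w y‖ ≤ ‖g i y‖ + L * ‖w y‖ := by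
      refine (norm_sub_le _ _).trans ?_
      rw [norm_smul, norm_smul, Real.norm_eq_abs, Real.norm_eq_abs]
      have := hL i
      gcongr
      exact mul_le_of_le_one_left (norm_nonneg _) hb
    calc _ ≤ (‖g i y‖ + L * ‖w y‖) ^ 2 := by gcongr
      _ ≤ _ := by nlinarith [sq_nonneg (‖g i y‖ - L * ‖w y‖)]
  have hs := Finset.sum_le_sum fun i (_ : i ∈ Finset.univ) => hg i
  rw [Finset.sum_add_distrib, ← Finset.mul_sum, Finset.sum_const, Finset.card_univ,
    Fintype.card_fin, nsmul_eq_mul] at hs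
  have hX : 0 ≤ ∑ i, ‖g i y‖ ^ 2 := Finset.sum_nonneg fun i _ => by positivity
  rw [energyDensity]
  have h5 : 0 ≤ 2 * d * L ^ 2 * ∑ i, ‖g i y‖ ^ 2 := by positivity
  nlinarith [sq_nonneg ‖w y‖]

/-- The difference between a solution in `H¹₀(Ω)` and a solution on the whole space is controlled
by the energy of the latter outside a ball contained in `Ω`. -/
theorem exists_energy_sub_le [NeZero d] (hA : A.PosDef) (hA₁ : A₁.PosDef) (hB : MeasurableSet B)
    {w : Eu d → ℂ} {g : Fin d → Eu d → ℂ} (hw : MemLp w 2 volume)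
    (hg : ∀ i, HasWeakPartial Set.univ i w (g i)) :
    ∃ C : ℝ, 0 < C ∧ ∀ (Ω : Set (Eu d)) (u : Eu d → ℂ) (R : ℝ), IsOpen Ω → 1 ≤ R →
      Metric.closedBall 0 (2 * R) ⊆ Ω → MemH10 Ω u →
      (∀ φ : Eu d → ℂ, IsTest Ω φ →
        pairing Ω (flux A A₁ B fun i => weakPartial Ω i u) (fun y => Amin A * u y) φ
          (fun i => partialD i φ) =
        pairing Ω (flux A A₁ B g) (fun y => Amin A * w y) φ (fun i => partialD i φ)) →
      ∫ y in Ω, energyDensity (fun y => u y - w y) (fun i y => weakPartial Ω i u y - g i y) y ≤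
        C * ∫ y in tailSet d R, energyDensity w g y := by
  obtain ⟨c, K, hc, hK, hcA, hell⟩ := exists_ellipticity hA hA₁ B
  obtain ⟨L, hL, hcut⟩ := exists_cutoff d
  have hg2 : ∀ i, MemLp (g i) 2 volume := fun i => by simpa using (hg i).1
  have hAm : 0 < Amin A := hc.trans_le hcA
  refine ⟨2 * (K * d + Amin A) ^ 2 / c * (2 + 2 * d * L ^ 2) / (c / 2), by positivity,
    fun Ω u R hΩ hR hsub hu heq => ?_⟩
  have hR0 : 0 < R := one_pos.trans_le hR
  obtain ⟨β, hβ, hβs, hβ01, hβ1, -, hβL, hβ0⟩ := hcut R hR0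
  have hβt : IsTest Ω β := ⟨hβ.1, hβ.2.1, hβs.trans hsub⟩
  have hu2 := hu.1.1
  have hup : ∀ i, MemLp (weakPartial Ω i u) 2 (volume.restrict Ω) := fun i =>
    (hu.1.hasWeakPartial i).1
  have hw2 := hw.restrict Ω
  have hg2' := fun i => (hg2 i).restrict Ω
  set v : Eu d → ℂ := fun y => u y - w y with hv
  set G : Fin d → Eu d → ℂ := fun i y => weakPartial Ω i u y - g i y with hG
  have hv2 : MemLp v 2 (volume.restrict Ω) := hu2.sub hw2
  have hG2 : ∀ i, MemLp (G i) 2 (volume.restrict Ω) := fun i => (hup i).sub (hg2' i)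
  have hF := memLp_flux (A := A) (A₁ := A₁) hB hG2
  have hf : MemLp (fun y => (Amin A : ℂ) * v y) 2 (volume.restrict Ω) := hv2.const_mul _
  have horth : ∀ φ : Eu d → ℂ, IsTest Ω φ → pairing Ω (flux A A₁ B G)
      (fun y => Amin A * v y) φ (fun i => partialD i φ) = 0 := by
    intro φ hφ
    have hφ2 : MemLp φ 2 (volume.restrict Ω) :=
      hφ.1.continuous.memLp_of_hasCompactSupport hφ.2.1
    have hφp := fun i => partialD_memLp hφ.1 hφ.2.1 i 2 (volume.restrict Ω)
    have h := sub_eq_zero.2 (heq φ hφ)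
    rw [pairing, pairing, ← integral_sub
      (integrable_pairing (memLp_flux hB hup) (hu2.const_mul _) hφ2 hφp)
      (integrable_pairing (memLp_flux hB hg2') (hw2.const_mul _) hφ2 hφp)] at h
    rw [pairing, ← h]
    congr 1 with y
    simp only [hG, hv, flux_sub, sub_mul, mul_sub, Finset.sum_sub_distrib]
    ring
  -- The equation for v is tested with u, a limit of test functions, and with βw, a compactly
  -- supported cut-off. The difference w itself need not vanish on the boundary of Ω, so v is not
  -- admissible.
  have z1 := pairing_eq_zero_of_memH10 hΩ hF hf horth hu
  have z2 := pairing_cutoff_eq_zero hF hf horth hw hg hβt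
  have i1 := integrable_pairing hF hf hu2 hup
  have i2 := integrable_pairing hF hf (memLp_smul hβ.1.continuous hβ.2.1 hw2)
    (memLp_cutoff_partial hβ hw2 hg2')
  have hint := i1.sub i2
  have hzero : ∫ y in Ω, ((((∑ i, flux A A₁ B G i y * conj (weakPartial Ω i u y)) +
      Amin A * v y * conj (u y)) - ((∑ i, flux A A₁ B G i y *
        conj (β y • g i y + partialD i β y • w y)) +
      Amin A * v y * conj (β y • w y))) : ℂ) = 0 := by
    rw [integral_sub i1 i2]
    exact sub_eq_zero.2 (z1.trans z2.symm)
  have hre := integral_re hint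
  simp only [Pi.sub_apply] at hre
  rw [hzero] at hre
  have he : Integrable (energyDensity w g) (volume.restrict Ω) :=
    (integrable_energyDensity hw hg2).restrict
  have heT : Integrable (energyDensity w g) (volume.restrict (tailSet d R)) :=
    (integrable_energyDensity hw hg2).restrict
  have hev := integrable_energyDensity hv2 hG2
  have hm : MeasurableSet (tailSet d R) := (isClosed_tailSet _).measurableSet
  set C₁ := 2 * (K * d + Amin A) ^ 2 / c with hC₁
  set C₂ := 2 + 2 * (d : ℝ) * L ^ 2 with hC₂
  have hC₁0 : 0 ≤ C₁ := by positivity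
  have hpt : ∀ y, c / 2 * energyDensity v G y -
      C₁ * C₂ * (tailSet d R).indicator (energyDensity w g) y ≤
      RCLike.re ((((∑ i, flux A A₁ B G i y * conj (weakPartial Ω i u y)) +
      Amin A * v y * conj (u y)) - ((∑ i, flux A A₁ B G i y *
        conj (β y • g i y + partialD i β y • w y)) +
      Amin A * v y * conj (β y • w y))) : ℂ) := by
    intro y
    -- The perturbation is (1 - β)w with its gradient, so that v plus the perturbation is exactly
    -- the admissible function u - βw.
    have h := re_perturbed_form_ge (hell y).1 hK (hell y).2 hcA hc (v y) ((1 - β y) • w y)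
      (fun i => G i y) (fun i => (1 - β y) • g i y - partialD i β y • w y)
    have e : (∑ i, (∑ j, (coeff A A₁ B y i j : ℂ) * G j y) *
          conj (G i y + ((1 - β y) • g i y - partialD i β y • w y))) +
          Amin A * v y * conj (v y + (1 - β y) • w y) =
        (((∑ i, flux A A₁ B G i y * conj (weakPartial Ω i u y)) +
        Amin A * v y * conj (u y)) - ((∑ i, flux A A₁ B G i y *
          conj (β y • g i y + partialD i β y • w y)) +
        Amin A * v y * conj (β y • w y))) := by
      have e1 : v y + (1 - β y) • w y = u y - β y • w y := by
        simp only [hv, sub_smul, one_smul]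
        ring
      have e2 : ∀ i, G i y + ((1 - β y) • g i y - partialD i β y • w y) =
          weakPartial Ω i u y - (β y • g i y + partialD i β y • w y) := fun i => by
        simp only [hG, sub_smul, one_smul]
        ring
      simp only [e1, e2, map_sub, mul_sub, Finset.sum_sub_distrib, flux]
      ring
    rw [e] at h
    refine le_trans (sub_le_sub_left ?_ _) h
    rw [mul_assoc]
    refine mul_le_mul_of_nonneg_left ?_ hC₁0
    by_cases hy : R ≤ ‖y‖
    · rw [Set.indicator_of_mem (show y ∈ tailSet d R from hy)]
      exact energyDensity_cutoff_le (hβ01 y).1 (hβ01 y).2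
        (fun i => (hβL i y).trans (div_le_self hL.le hR)) w g
    -- Here |y| < R strictly, so both 1 - β and the gradient of β vanish at y and the perturbation
    -- contributes nothing.
    · rw [Set.indicator_of_notMem (show y ∉ tailSet d R from hy)]
      simp [hβ1 y (not_le.1 hy).le, fun i => hβ0 i y (not_le.1 hy)]
  have hmain := integral_mono ((hev.const_mul (c / 2)).sub
    ((he.indicator hm).const_mul (C₁ * C₂))) hint.re hpt
  simp only [Pi.sub_apply] at hmain
  rw [hre, integral_sub (hev.const_mul _) ((he.indicator hm).const_mul _), integral_const_mul,
    integral_const_mul, setIntegral_indicator hm] at hmain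
  have hmono : ∫ y in Ω ∩ tailSet d R, energyDensity w g y ≤
      ∫ y in tailSet d R, energyDensity w g y :=
    setIntegral_mono_set heT (Eventually.of_forall fun y => energyDensity_nonneg w g y)
      (Eventually.of_forall Set.inter_subset_right)
  rw [div_mul_eq_mul_div, le_div_iff₀ (by positivity)]
  have h6 : C₁ * C₂ * ∫ y in Ω ∩ tailSet d R, energyDensity w g y ≤
      C₁ * C₂ * ∫ y in tailSet d R, energyDensity w g y :=
    mul_le_mul_of_nonneg_left hmono (by positivity)
  simp only [map_zero] at hmain
  linarith

end Comparison

/-! ### Change of variables and orders in ε -/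

section Scaling

variable {d : ℕ} {Ω : Set (Eu d)}

/-- Gradients gain c², the L² term does not; since c ≥ 1 the factor c² may be put on both, so the
full energy appears. -/
theorem h1Norm_comp_smul_le {c : ℝ} (hc : 1 ≤ c) (hΩ : IsOpen Ω) {u : Eu d → ℂ}
    {g : Fin d → Eu d → ℂ} (hu : MemLp u 2 (volume.restrict (c • Ω)))
    (hg : ∀ i, HasWeakPartial (c • Ω) i u (g i)) :
    h1Norm Ω (fun x => u (c • x)) ≤
      Real.sqrt (c ^ 2 * (c ^ d)⁻¹ * ∫ y in c • Ω, energyDensity u g y) := by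
  have hc0 : 0 < c := one_pos.trans_le hc
  refine Real.sqrt_le_sqrt ?_
  have h1 : ∫ x in Ω, ‖u (c • x)‖ ^ 2 = (c ^ d)⁻¹ * ∫ y in c • Ω, ‖u y‖ ^ 2 := by
    rw [Measure.setIntegral_comp_smul_of_pos volume (fun y => ‖u y‖ ^ 2) Ω hc0,
      finrank_euclideanSpace_fin, smul_eq_mul]
  have h2 : ∀ i, ∫ x in Ω, ‖weakPartial Ω i (fun x => u (c • x)) x‖ ^ 2 =
      c ^ 2 * (c ^ d)⁻¹ * ∫ y in c • Ω, ‖g i y‖ ^ 2 := fun i => by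
    have e : ∫ x in Ω, ‖weakPartial Ω i (fun x => u (c • x)) x‖ ^ 2 =
        ∫ x in Ω, c ^ 2 * ‖g i (c • x)‖ ^ 2 := by
      refine integral_congr_ae ?_
      filter_upwards [((hg i).comp_smul hc0).weakPartial_ae_eq hΩ] with x hx
      rw [hx, norm_smul, mul_pow, Real.norm_of_nonneg hc0.le]
    rw [e, integral_const_mul,
      Measure.setIntegral_comp_smul_of_pos volume (fun y => ‖g i y‖ ^ 2) Ω hc0,
      finrank_euclideanSpace_fin, smul_eq_mul, mul_assoc]
  simp only [h1, h2, energyDensity]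
  rw [integral_add (hu.integrable_norm_pow (by simp))
    (integrable_finsetSum _ fun i _ => (hg i).1.integrable_norm_pow (by simp)),
    integral_finsetSum _ fun i _ => (hg i).1.integrable_norm_pow (by simp), mul_add,
    ← Finset.mul_sum]
  gcongr
  exact le_mul_of_one_le_left (by positivity) (one_le_pow₀ hc)

theorem isLittleO_of_le_rpow {F : ℝ → ℝ} {C a b : ℝ} (hF : ∀ ε, 0 ≤ F ε) (hab : a < b)
    (h : ∀ᶠ ε in 𝓝[>] (0 : ℝ), F ε ≤ C * ε ^ b) : F =o[𝓝[>] 0] fun ε : ℝ => ε ^ a := by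
  have h1 : F =O[𝓝[>] 0] fun ε : ℝ => ε ^ b := by
    refine IsBigO.of_bound C ?_
    filter_upwards [h, self_mem_nhdsWithin] with ε hε hpos
    rw [Real.norm_of_nonneg (hF ε), Real.norm_of_nonneg (Real.rpow_nonneg (le_of_lt hpos) _)]
    exact hε
  refine h1.trans_isLittleO ?_
  have h2 : Tendsto (fun ε : ℝ => ε ^ (b - a)) (𝓝[>] 0) (𝓝 0) := by
    have := (Real.continuousAt_rpow_const 0 (b - a) (Or.inr (by linarith))).tendsto
    rw [Real.zero_rpow (by linarith)] at this
    exact this.mono_left nhdsWithin_le_nhds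
  refine isLittleO_of_tendsto' ?_ (h2.congr' ?_)
  · filter_upwards [self_mem_nhdsWithin] with ε hε h0
    exact absurd h0 (Real.rpow_pos_of_pos hε _).ne'
  · filter_upwards [self_mem_nhdsWithin] with ε hε
    rw [Real.rpow_sub hε]

end Scaling

/-! ### Assembling the estimate -/

section Main

variable {d : ℕ} {A A₁ : Matrix (Fin d) (Fin d) ℝ} {B : Set (Eu d)} {p : Fin d → ℂ}

/-- The energy of the whole-space corrector decays faster than any power. -/
theorem IsWholeSpaceCorrector.tail_energy_le [NeZero d] (hA : A.PosDef) (hA₁ : A₁.PosDef)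
    (hB : IsOpen B) (hBb : Bornology.IsBounded B) {w : Eu d → ℂ}
    (hw : IsWholeSpaceCorrector A A₁ B p w) (k : ℕ) :
    ∃ C R₀ : ℝ, 0 ≤ C ∧ ∀ R, R₀ < R →
      ∫ y in tailSet d R, energyDensity w (fun i => weakPartial Set.univ i w) y ≤ C / R ^ k := by
  obtain ⟨r, hr, hBr⟩ := hBb.subset_closedBall_lt 0 (0 : Eu d)
  have hw2 : MemLp w 2 volume := by simpa using hw.1.1
  have hg := fun i => hw.1.hasWeakPartial i
  have hint : Integrable (energyDensity w (fun i => weakPartial Set.univ i w)) volume :=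
    integrable_energyDensity hw2 fun i => by simpa using (hg i).1
  obtain ⟨C, hC, hshell⟩ := energy_shell_le hA hA₁ hB.measurableSet hr hw2 hg fun φ hφ => by
    rw [← pairing_of_isTest hφ (Set.subset_univ _), ← correctorForm_eq_pairing,
      hw.2 φ (hφ.mono (Set.subset_univ _))]
    -- The source lives on the boundary of B, which lies in the closed ball of radius r, where φ
    -- vanishes.
    refine setIntegral_eq_zero_of_forall_eq_zero fun y hy => ?_
    have hy' : y ∈ Metric.closedBall (0 : Eu d) r :=
      closure_minimal hBr Metric.isClosed_closedBall (frontier_subset_closure hy)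
    rw [hφ.eq_zero fun h => h hy', map_zero, mul_zero]
  obtain ⟨C', hC', h⟩ := exists_le_div_pow_of_doubling
    (E := fun R => ∫ y in tailSet d R, energyDensity w (fun i => weakPartial Set.univ i w) y)
    (E₀ := ∫ y, energyDensity w (fun i => weakPartial Set.univ i w) y) hr hC
    (integral_nonneg fun y => energyDensity_nonneg _ _ y)
    (fun R => setIntegral_le_integral hint
      (Eventually.of_forall fun y => energyDensity_nonneg _ _ y))
    (fun R hR => tail_energy_doubling hint hr hshell hR) k
  exact ⟨C', 2 ^ k * r, hC', h⟩

theorem corrector_difference_bound [NeZero d] {D : Set (Eu d)} (hD : IsOpen D)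
    (h0 : (0 : Eu d) ∈ D) (hB : IsOpen B) (hBb : Bornology.IsBounded B) (hA : A.PosDef)
    (hA₁ : A₁.PosDef) {wε : ℝ → Eu d → ℂ} {w : Eu d → ℂ}
    (hwε : ∀ᶠ ε in 𝓝[>] (0 : ℝ), IsDirichletCorrector A A₁ B (ε⁻¹ • D) p (wε ε))
    (hw : IsWholeSpaceCorrector A A₁ B p w) :
    ∃ C : ℝ, ∀ᶠ ε in 𝓝[>] (0 : ℝ), MemH1 D (fun x => wε ε (ε⁻¹ • x) - w (ε⁻¹ • x)) ∧
      h1Norm D (fun x => wε ε (ε⁻¹ • x) - w (ε⁻¹ • x)) ≤ C * ε ^ ((d : ℝ) / 2 + 3) := by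
  have hw2 : MemLp w 2 volume := by simpa using hw.1.1
  have hg := fun i => hw.1.hasWeakPartial i
  -- Order k yields the exponent d/2 - 1 + k/2 for the norm; 8 is the least integer k for which this
  -- exceeds d/2 + 5/2.
  obtain ⟨C₁, R₀, hC₁, htail⟩ := hw.tail_energy_le hA hA₁ hB hBb 8
  obtain ⟨C₂, hC₂, hcomp⟩ := exists_energy_sub_le hA hA₁ hB.measurableSet hw2 hg
  obtain ⟨r, hr, hrD⟩ := Metric.isOpen_iff.1 hD 0 h0
  have hlim : Tendsto (fun ε : ℝ => r / 3 * ε⁻¹) (𝓝[>] 0) atTop :=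
    tendsto_inv_nhdsGT_zero.const_mul_atTop (by positivity)
  refine ⟨Real.sqrt (C₂ * C₁ * (3 / r) ^ 8), ?_⟩
  filter_upwards [hwε, self_mem_nhdsWithin, hlim.eventually_gt_atTop R₀,
    hlim.eventually_ge_atTop 1, tendsto_inv_nhdsGT_zero.eventually_ge_atTop (1 : ℝ)]
    with ε hu hε hR₀ hR1 hε1
  have hε : (0 : ℝ) < ε := hε
  have hi : 0 < ε⁻¹ := inv_pos.2 hε
  set Ω := ε⁻¹ • D with hΩdef
  have hΩ : IsOpen Ω := hD.smul₀ hi.ne'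
  -- The factor 1/3 leaves room: the ball of radius 2R, scaled back by ε, has radius 2r/3 < r and so
  -- lies in D.
  set R := r / 3 * ε⁻¹ with hR
  have hsub : Metric.closedBall 0 (2 * R) ⊆ Ω := by
    intro y hy
    rw [hΩdef, Set.mem_smul_set_iff_inv_smul_mem₀ hi.ne', inv_inv]
    apply hrD
    rw [mem_ball_zero_iff, norm_smul, Real.norm_of_nonneg hε.le]
    rw [mem_closedBall_zero_iff] at hy
    calc ε * ‖y‖ ≤ ε * (2 * R) := by gcongr
      _ = 2 / 3 * r := by rw [hR]; field_simp
      _ < r := by linarith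
  have hup := fun i => hu.1.1.hasWeakPartial i
  have hv2 : MemLp (fun y => wε ε y - w y) 2 (volume.restrict Ω) := hu.1.1.1.sub (hw2.restrict Ω)
  have hvp : ∀ i, HasWeakPartial Ω i (fun y => wε ε y - w y)
      (fun y => weakPartial Ω i (wε ε) y - weakPartial Set.univ i w y) := fun i =>
    (hup i).sub hu.1.1.1 (hw2.restrict Ω) ((hg i).mono (Set.subset_univ _))
  refine ⟨⟨memLp_comp_const_smul hi hv2, fun i => ⟨_, (hvp i).comp_smul hi⟩⟩, ?_⟩
  have henergy := hcomp Ω (wε ε) R hΩ hR1 hsub hu.1 fun φ hφ => by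
    rw [← correctorForm_eq_pairing, hu.2 φ hφ, ← pairing_of_isTest hφ (Set.subset_univ _),
      ← correctorForm_eq_pairing, hw.2 φ (hφ.mono (Set.subset_univ _))]
  refine (h1Norm_comp_smul_le hε1 hD hv2 hvp).trans ?_
  have hnn : 0 ≤ C₂ * C₁ * (3 / r) ^ 8 := by positivity
  have hpow : ε ^ ((d : ℝ) / 2 + 3) = Real.sqrt (ε ^ (d + 6)) := by
    rw [Real.sqrt_eq_rpow, ← Real.rpow_natCast, ← Real.rpow_mul hε.le]
    congr 1
    push_cast
    ring
  rw [hpow, ← Real.sqrt_mul hnn]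
  refine Real.sqrt_le_sqrt ?_
  calc ε⁻¹ ^ 2 * (ε⁻¹ ^ d)⁻¹ * _ ≤ ε⁻¹ ^ 2 * (ε⁻¹ ^ d)⁻¹ * (C₂ * (C₁ / R ^ 8)) := by
        gcongr
        exact henergy.trans (mul_le_mul_of_nonneg_left (htail R hR₀) hC₂.le)
    _ = C₂ * C₁ * (3 / r) ^ 8 * ε ^ (d + 6) := by
        rw [hR, inv_pow ε d, inv_inv, pow_add]
        field_simp

end Main

end

theorem mainTheorem7 {d : ℕ} (hd : d = 2 ∨ d = 3)
    (D : Set (Eu d)) (hD : IsOpen D) (hDb : Bornology.IsBounded D) (h0 : (0 : Eu d) ∈ D)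
    (B : Set (Eu d)) (hB : IsOpen B) (hBb : Bornology.IsBounded B) (hBs : HasSmoothBoundary B)
    (A A₁ : Matrix (Fin d) (Fin d) ℝ) (hA : A.PosDef) (hA₁ : A₁.PosDef)
    (w : Eu d → ℂ) (hw : ContDiffOn ℝ ∞ w D)
    (wε : ℝ → Eu d → ℂ) (w1 : Eu d → ℂ)
    (hwε : ∀ᶠ ε in 𝓝[>] (0 : ℝ),
      IsDirichletCorrector A A₁ B (ε⁻¹ • D) (fun j => partialD j w 0) (wε ε))
    (hw1 : IsWholeSpaceCorrector A A₁ B (fun j => partialD j w 0) w1) :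
    (∀ᶠ ε in 𝓝[>] (0 : ℝ), MemH1 D (fun x => wε ε (ε⁻¹ • x) - w1 (ε⁻¹ • x))) ∧
    (d = 2 →
      (fun ε : ℝ => h1Norm D (fun x => wε ε (ε⁻¹ • x) - w1 (ε⁻¹ • x)))
        =o[𝓝[>] 0] fun ε : ℝ => ε ^ ((d : ℝ) / 2 + 2)) ∧
    (d = 3 →
      (fun ε : ℝ => h1Norm D (fun x => wε ε (ε⁻¹ • x) - w1 (ε⁻¹ • x)))
        =o[𝓝[>] 0] fun ε : ℝ => ε ^ ((d : ℝ) / 2 + 5 / 2)) := by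

  have : NeZero d := ⟨by rcases hd with h | h <;> omega⟩
  obtain ⟨C, hC⟩ := corrector_difference_bound hD h0 hB hBb hA hA₁ hwε hw1
  -- The bound with exponent d/2 + 3 beats both d/2 + 2 and d/2 + 5/2 strictly, which turns O into
  -- o.
  refine ⟨hC.mono fun ε h => h.1, fun _ => ?_, fun _ => ?_⟩
  · exact isLittleO_of_le_rpow (fun ε => Real.sqrt_nonneg _) (by linarith)
      (hC.mono fun ε h => h.2)
  · exact isLittleO_of_le_rpow (fun ε => Real.sqrt_nonneg _) (by linarith)
      (hC.mono fun ε h => h.2)
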